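/- Let $(\Omega,\mathcal F,P)$ be a non-atomic probability space. Let $L^\infty_{++}$ be the set of ($P$-a.s. equivalence classes of) essentially bounded random variables $X$ that are strictly positive and bounded away from zero, i.e. $X\ge\varepsilon$ $P$-a.s. for some real $\varepsilon>0$ (equivalently, $X=e^{Z}$ with $Z\in L^\infty$), and let $\mathcal Q$ be the set of all probability measures on $(\Omega,\mathcal F)$ that are absolutely continuous with respect to $P$. Let $\tilde\rho\colon L^\infty_{++}\to[0,\infty]$ be - monotone: $X\le Y$ $P$-a.s. implies $\tilde\rho(X)\le\tilde\rho(Y)$; - quasi-logconvex: $\tilde\rho(X^{\alpha}Y^{1-\alpha})\le\max\{\tilde\rho(X),\tilde\rho(Y)\}$ for all $X,Y\in L^\infty_{++}$ and $\alpha\in(0,1)$; - continuous from below: $X_n\uparrow X$ $P$-a.s., with $X_n,X\in L^\infty_{++}$, implies $\tilde\rho(X_n)\to\tilde\rho(X)$; - law invariant: $\tilde\rho(X)=\tilde\rho(Y)$ whenever $X$ and $Y$ have the same distribution under $P$. For $Q\in\mathcal Q$ and $X\in L^\infty_{++}$ let $H_{0,Q}(X)=\inf\{k>0:\mathbb E_Q[\log(X/k)]\le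 0\}$ be the canonical Orlicz premium, and for $s\in(0,\infty)$ and $Q\in\mathcal Q$ let $$R(s;Q)=\inf\{\tilde\rho(Y): Y\in L^\infty_{++},\ \mathbb E_Q[\log Y]\ge\log s\}\in[0,\infty],\qquad \inf\emptyset=\infty .$$ Then $H_{0,Q}(X)=\exp(\mathbb E_Q[\log X])$ for all $Q\in\mathcal Q$ and $X\in L^\infty_{++}$. Moreover, for every $X\in L^\infty_{++}$, $$\tilde\rho(X)=\sup_{Q\in\mathcal Q}R\Big(\sup_{\tilde Q}H_{0,\tilde Q}(X);\,Q\Big)=\sup_{Q\in\mathcal Q}\ \sup_{\tilde Q}R\big(H_{0,\tilde Q}(X);\,Q\big),$$ where, for each $Q$, both inner suprema run over all $\tilde Q\in\mathcal Q$ whose density $d\tilde Q/dP$ has the same distribution under $P$ as $dQ/dP$, and $\sup_{\tilde Q}H_{0,\tilde Q}(X)$ is finite. -/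

import Mathlib

open MeasureTheory ProbabilityTheory Filter Topology
open scoped ENNReal

namespace ReturnRisk

variable {Ω : Type*} [MeasurableSpace Ω]

/-- A measure is non-atomic if every measurable set of positive measure has a measurable subset
of strictly smaller positive measure. (On a general measurable space this is stronger than the
vanishing of the measure on singletons.) -/
def IsNonatomic (P : Measure Ω) : Prop :=
  ∀ A : Set Ω, MeasurableSet A → 0 < P A →
    ∃ B : Set Ω, B ⊆ A ∧ MeasurableSet B ∧ 0 < P B ∧ P B < P A

/-- The positive cone `L^∞_{++}(Ω, F, P) = exp (L^∞)`: classes (modulo `P`-a.s. equality) of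
essentially bounded random variables that are strictly positive, i.e. bounded away from `0`,
so that `log X` is again an element of `L^∞`. -/
def LInftyPos (P : Measure Ω) : Type _ :=
  {X : Lp ℝ ∞ P // ∃ ε : ℝ, 0 < ε ∧ ∀ᵐ ω ∂P, ε ≤ X ω}

noncomputable instance (P : Measure Ω) : CoeFun (LInftyPos P) (fun _ => Ω → ℝ) :=
  ⟨fun X => (X.1 : Ω → ℝ)⟩

/-- The set `𝒬` of probability measures that are absolutely continuous with respect to `P`. -/
def AbsContProb (P : Measure Ω) : Type _ :=
  {Q : Measure Ω // IsProbabilityMeasure Q ∧ Q ≪ P}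

/-- `X ≤ Y` `P`-a.s. implies `ρ X ≤ ρ Y`. -/
def IsMonotone {P : Measure Ω} (ρ : LInftyPos P → ℝ≥0∞) : Prop :=
  ∀ X Y : LInftyPos P, (∀ᵐ ω ∂P, X ω ≤ Y ω) → ρ X ≤ ρ Y

/-- `ρ (X ^ α * Y ^ (1 - α)) ≤ max (ρ X) (ρ Y)` for `α ∈ (0, 1)`; the variable `Z` is the element
`X ^ α * Y ^ (1 - α)` of `L^∞_{++}`. -/
def IsQuasiLogconvex {P : Measure Ω} (ρ : LInftyPos P → ℝ≥0∞) : Prop :=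
  ∀ (X Y Z : LInftyPos P) (α : ℝ), 0 < α → α < 1 →
    (∀ᵐ ω ∂P, Z ω = (X ω) ^ α * (Y ω) ^ (1 - α)) → ρ Z ≤ max (ρ X) (ρ Y)

/-- `X_n ↑ X` `P`-a.s. implies `ρ X_n → ρ X`. -/
def IsContinuousFromBelow {P : Measure Ω} (ρ : LInftyPos P → ℝ≥0∞) : Prop :=
  ∀ (X : ℕ → LInftyPos P) (X' : LInftyPos P),
    (∀ᵐ ω ∂P, Monotone (fun n => X n ω)) →
    (∀ᵐ ω ∂P, Tendsto (fun n => X n ω) atTop (𝓝 (X' ω))) →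
      Tendsto (fun n => ρ (X n)) atTop (𝓝 (ρ X'))

/-- `ρ X = ρ Y` whenever `X` and `Y` have the same distribution under `P`. -/
def IsLawInvariant {P : Measure Ω} (ρ : LInftyPos P → ℝ≥0∞) : Prop :=
  ∀ X Y : LInftyPos P, IdentDistrib X Y P P → ρ X = ρ Y

/-- The canonical Orlicz premium `H_{0,Q}(X) = inf {k > 0 | E_Q[log (X / k)] ≤ 0}`. -/
noncomputable def orliczPremium {P : Measure Ω} (Q : AbsContProb P) (X : LInftyPos P) : ℝ :=
  sInf {k : ℝ | 0 < k ∧ ∫ ω, Real.log (X ω / k) ∂Q.1 ≤ 0}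

/-- `𝓡(t; Q) = inf {ρ Y | Y ∈ L^∞_{++}, E_Q[log Y] ≥ t}`, with values in `[0, ∞]`
(and `inf ∅ = ∞`). -/
noncomputable def dualFun {P : Measure Ω} (ρ : LInftyPos P → ℝ≥0∞) (t : ℝ)
    (Q : AbsContProb P) : ℝ≥0∞ :=
  ⨅ (Y : LInftyPos P) (_ : t ≤ ∫ ω, Real.log (Y ω) ∂Q.1), ρ Y

/-- `R(s; Q) = 𝓡(log s; Q)` for `s > 0`. -/
noncomputable def geomDualFun {P : Measure Ω} (ρ : LInftyPos P → ℝ≥0∞) (s : ℝ)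
    (Q : AbsContProb P) : ℝ≥0∞ :=
  dualFun ρ (Real.log s) Q

/-- The measures `Q' ∈ 𝒬` whose density `dQ'/dP` has the same distribution under `P` as
`dQ/dP`. -/
def SameDensityLaw {P : Measure Ω} (Q : AbsContProb P) : Type _ :=
  {Q' : AbsContProb P // IdentDistrib (Q'.1.rnDeriv P) (Q.1.rnDeriv P) P P}

end ReturnRisk

namespace ReturnRisk

/-! ### Non-atomic spaces carry atomless random variables -/

section Atomless

variable {Ω : Type*} [MeasurableSpace Ω] {P : Measure Ω}

/-! On the logarithmic scale the sublevel sets of `ρ` are convex, law invariant, closed downwards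
and closed under bounded increasing limits (`IsLowerFamily`). The two bounds of the representation
are separate matters.

Upper bound: given `Q` and `X`, non-atomicity provides `Y` with the law of `X`, ordered like
`dQ/dP`. By Hardy–Littlewood, `E_Q[log Y]` dominates `E_{Q'}[log X]` for every `Q'` with the density
law of `Q`, so `Y` competes in the infimum defining `R`, with `ρ Y = ρ X`.

Lower bound: for `c < ρ X`, separate `log X` from `C = {ρ ≤ c}` by a countably additive probability
(`IsLowerFamily.exists_integral_lt`), and take `Q' = Q`. The difficulty is that `C` is not known to
be closed in `L²`; only its uniformly bounded parts are. Law invariance helps: `C` is stable under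
averaging over the cells of a countable partition (`IsLowerFamily.cellAverage_mem`). Otherwise some
`h` in `L²` would separate the average from a bounded part of `C`, but rearranging within cells to
follow `h` stays in `C` and, by Chebyshev's inequality, does at least as well against `h`. Averaging
over finitely many cells turns `L¹` closeness into uniform closeness, so a simple function outside
`C` by a margin lies outside the `L²` closure of `C`. Hahn–Banach in `L²` then gives a density,
nonnegative because `C` is closed downwards. -/

lemma IsNonatomic.exists_subset_le [IsFiniteMeasure P] (hP : IsNonatomic P) {A : Set Ω}
    (hA : MeasurableSet A) (hA0 : 0 < P A) {ε : ℝ≥0∞} (hε : 0 < ε) :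
    ∃ B ⊆ A, MeasurableSet B ∧ 0 < P B ∧ P B ≤ ε := by
  -- Of `B` and `A \ B`, one has at most half the mass of `A`; iterating reaches any `ε`.
  have half : ∀ A : Set Ω, MeasurableSet A → 0 < P A →
      ∃ B ⊆ A, MeasurableSet B ∧ 0 < P B ∧ P B ≤ P A * 2⁻¹ := by
    intro A hA hA0
    obtain ⟨B, hBA, hB, hB0, hlt⟩ := hP A hA hA0
    have hsum : P B + P (A \ B) = P A := by
      rw [← measure_inter_add_sdiff A hB, Set.inter_eq_self_of_subset_right hBA]
    by_cases h : P B ≤ P A * 2⁻¹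
    · exact ⟨B, hBA, hB, hB0, h⟩
    · push Not at h
      refine ⟨A \ B, Set.sdiff_subset, hA.diff hB, ?_, ?_⟩
      · by_contra h0
        have : P (A \ B) = 0 := by simpa using h0
        rw [this, add_zero] at hsum
        exact hlt.ne hsum
      · by_contra! h2
        have h3 : P A * 2⁻¹ + P A * 2⁻¹ < P B + P (A \ B) := ENNReal.add_lt_add h h2
        rw [hsum, ← mul_add, ENNReal.inv_two_add_inv_two, mul_one] at h3
        exact lt_irrefl _ h3
  have iter : ∀ n : ℕ, ∃ B ⊆ A, MeasurableSet B ∧ 0 < P B ∧ P B ≤ P A * 2⁻¹ ^ n := by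
    intro n
    induction n with
    | zero => exact ⟨A, subset_rfl, hA, hA0, by simp⟩
    | succ n ih =>
      obtain ⟨B, hBA, hB, hB0, hle⟩ := ih
      obtain ⟨D, hDB, hD, hD0, hle'⟩ := half B hB hB0
      refine ⟨D, hDB.trans hBA, hD, hD0, hle'.trans ?_⟩
      rw [pow_succ, ← mul_assoc]
      gcongr
  have hlim : Tendsto (fun n : ℕ => P A * (2⁻¹ : ℝ≥0∞) ^ n) atTop (𝓝 0) := by
    have := ENNReal.Tendsto.const_mul (a := P A)
      (ENNReal.tendsto_pow_atTop_nhds_zero_of_lt_one (r := 2⁻¹) (by simp))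
      (Or.inr (measure_ne_top P A))
    simpa using this
  obtain ⟨n, hn⟩ := (hlim.eventually (gt_mem_nhds hε)).exists
  obtain ⟨B, hBA, hB, hB0, hle⟩ := iter n
  exact ⟨B, hBA, hB, hB0, hle.trans hn.le⟩

/-- Up to a null set, a non-atomic finite measure space is a countable union of sets of measure at
most `ε`. -/
lemma IsNonatomic.exists_cover_le [IsFiniteMeasure P] (hP : IsNonatomic P) {ε : ℝ≥0∞}
    (hε : 0 < ε) :
    ∃ B : ℕ → Set Ω, (∀ n, MeasurableSet (B n)) ∧ (∀ n, P (B n) ≤ ε) ∧ P (⋃ n, B n)ᶜ = 0 := by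
  -- Exhaustion: a countable union of small sets attains the supremal measure, and a non-null
  -- complement would contain a further small set.
  let S : Set (Set Ω) := {A | ∃ B : ℕ → Set Ω, (∀ n, MeasurableSet (B n)) ∧ (∀ n, P (B n) ≤ ε) ∧
    A = ⋃ n, B n}
  have hSne : (P '' S).Nonempty :=
    ⟨_, ∅, ⟨fun _ => ∅, fun _ => MeasurableSet.empty, by simp, by simp⟩, rfl⟩
  obtain ⟨u, -, hu, huS⟩ := exists_seq_tendsto_sSup hSne (OrderTop.bddAbove _)
  choose A hAS hAu using huS
  choose B hBm hBε hAB using hAS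
  let e : ℕ ≃ ℕ × ℕ := (Denumerable.eqv (ℕ × ℕ)).symm
  let D : ℕ → Set Ω := fun n => B (e n).1 (e n).2
  have hDA : (⋃ n, D n) = ⋃ n, A n := by
    ext ω
    simp only [Set.mem_iUnion, D, hAB]
    exact ⟨fun ⟨n, h⟩ => ⟨_, _, h⟩, fun ⟨i, j, h⟩ => ⟨e.symm (i, j), by simpa using h⟩⟩
  have hmax : sSup (P '' S) ≤ P (⋃ n, D n) :=
    le_of_tendsto' hu fun n => by
      rw [← hAu n, hDA]
      exact measure_mono (Set.subset_iUnion A n)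
  have hDm : MeasurableSet (⋃ n, D n) := MeasurableSet.iUnion fun n => hBm _ _
  refine ⟨D, fun n => hBm _ _, fun n => hBε _ _, ?_⟩
  by_contra h0
  obtain ⟨C, hCD, hC, hC0, hCε⟩ := hP.exists_subset_le hDm.compl (pos_iff_ne_zero.2 h0) hε
  have hmem : (⋃ n, D n) ∪ C ∈ S := by
    refine ⟨fun n => Nat.casesOn n C D, ?_, ?_, ?_⟩
    · rintro (_ | n)
      exacts [hC, hBm _ _]
    · rintro (_ | n)
      exacts [hCε, hBε _ _]
    · ext ω
      simp only [Set.mem_union, Set.mem_iUnion]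
      constructor
      · rintro (⟨n, h⟩ | h)
        exacts [⟨n + 1, h⟩, ⟨0, h⟩]
      · rintro ⟨_ | n, h⟩
        exacts [Or.inr h, Or.inl ⟨n, h⟩]
  have h1 : P ((⋃ n, D n) ∪ C) ≤ P (⋃ n, D n) := (le_sSup (Set.mem_image_of_mem P hmem)).trans hmax
  rw [measure_union (Set.subset_compl_iff_disjoint_left.1 hCD) hC] at h1
  exact absurd h1 (not_le.2 (ENNReal.lt_add_right (measure_ne_top _ _) hC0.ne'))

/-- A non-atomic finite measure space carries a random variable without atoms. -/
lemma IsNonatomic.exists_atomless [IsFiniteMeasure P] (hP : IsNonatomic P) :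
    ∃ V : Ω → ℝ, Measurable V ∧ (∀ ω, 0 ≤ V ω) ∧ (∀ ω, V ω ≤ 1) ∧ ∀ v, P (V ⁻¹' {v}) = 0 := by
  have hpos : ∀ n : ℕ, (0 : ℝ≥0∞) < 2⁻¹ ^ n := fun n => ENNReal.pow_pos (by simp) n
  choose B hBm hBε hB0 using fun n : ℕ => hP.exists_cover_le (hpos n)
  classical
  -- The point is encoded by its memberships in all covers. A fibre of the code that meets every
  -- cover lies in one set of each, hence has mass at most `2⁻¹ ^ n` for all `n`; the remaining
  -- fibres lie in the null set missed by some cover.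
  let T : Ω → (ℕ → ℕ → Bool) := fun ω n k => decide (ω ∈ B n k)
  have hT : Measurable T := by
    refine measurable_pi_lambda _ fun n => measurable_pi_lambda _ fun k => ?_
    refine measurable_to_bool ?_
    have : (fun ω => T ω n k) ⁻¹' {true} = B n k := by
      ext ω; simp [T]
    rw [this]
    exact hBm n k
  have hinj : Function.Injective (embeddingReal (ℕ → ℕ → Bool)) :=
    (measurableEmbedding_embeddingReal _).injective
  refine ⟨fun ω => Real.sigmoid (embeddingReal _ (T ω)), ?_, fun ω => Real.sigmoid_nonneg _,
    fun ω => Real.sigmoid_le_one _, fun v => ?_⟩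
  · exact Real.sigmoid_monotone.measurable.comp
      ((measurableEmbedding_embeddingReal _).measurable.comp hT)
  · set E := (fun ω => Real.sigmoid (embeddingReal _ (T ω))) ⁻¹' {v} with hE
    by_cases hcov : ∃ ω₀ ∈ E, ∀ n, ∃ k, ω₀ ∈ B n k
    · obtain ⟨ω₀, hω₀, hk⟩ := hcov
      choose k hk using hk
      have hsub : ∀ n, E ⊆ B n (k n) := by
        intro n ω hω
        have h1 : T ω = T ω₀ := hinj (Real.sigmoid_injective (hω.trans hω₀.symm))
        have h2 : T ω n (k n) = T ω₀ n (k n) := by rw [h1]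
        simpa [T, hk n] using h2
      have hle : ∀ n : ℕ, P E ≤ (2⁻¹ : ℝ≥0∞) ^ n := fun n =>
        (measure_mono (hsub n)).trans (hBε n _)
      exact le_antisymm (ge_of_tendsto'
        (ENNReal.tendsto_pow_atTop_nhds_zero_of_lt_one (by simp)) hle) zero_le
    · push Not at hcov
      refine measure_mono_null (t := ⋃ n, (⋃ k, B n k)ᶜ) ?_ (measure_iUnion_null hB0)
      intro ω hω
      obtain ⟨n, hn⟩ := hcov ω hω
      exact Set.mem_iUnion.2 ⟨n, by simpa using hn⟩

end Atomless

/-! ### Quantile transport on the line -/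

section Quantile

lemma continuous_cdf (α : Measure ℝ) [IsProbabilityMeasure α] (hα : ∀ x, α {x} = 0) :
    Continuous (cdf α) := by
  refine continuous_iff_continuousAt.2 fun x => ?_
  rw [(monotone_cdf α).continuousAt_iff_leftLim_eq_rightLim, StieltjesFunction.rightLim_eq]
  have h := (cdf α).measure_singleton x
  rw [measure_cdf, hα x] at h
  have h1 := ENNReal.ofReal_eq_zero.1 h.symm
  exact le_antisymm ((monotone_cdf α).leftLim_le le_rfl) (by linarith)

/-- The probability integral transform. -/
lemma measure_cdf_le (α : Measure ℝ) [IsProbabilityMeasure α] (hα : ∀ x, α {x} = 0) {u : ℝ}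
    (hu0 : 0 ≤ u) (hu1 : u ≤ 1) : α {w | cdf α w ≤ u} = ENNReal.ofReal u := by
  have hcont := continuous_cdf α hα
  rcases hu1.eq_or_lt with rfl | hu1
  · have : {w | cdf α w ≤ 1} = Set.univ := by ext w; simp [cdf_le_one]
    rw [this]; simp
  obtain ⟨b, hb⟩ := ((tendsto_cdf_atTop α).eventually (lt_mem_nhds hu1)).exists
  have hbdd : BddAbove {w | cdf α w ≤ u} := ⟨b, fun w hw => by
    by_contra! h
    exact absurd ((monotone_cdf α h.le).trans hw) (not_le.2 hb)⟩
  rcases Set.eq_empty_or_nonempty {w | cdf α w ≤ u} with he | hne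
  · have h0 : u ≤ 0 := ge_of_tendsto' (tendsto_cdf_atBot α) fun w => by
      by_contra! h
      exact (Set.eq_empty_iff_forall_notMem.1 he w) h.le
    rw [he, measure_empty, ENNReal.ofReal_of_nonpos h0]
  · set s := sSup {w | cdf α w ≤ u} with hs
    have hsm : cdf α s ≤ u :=
      (isClosed_le hcont continuous_const).csSup_mem hne hbdd
    have hset : {w | cdf α w ≤ u} = Set.Iic s := by
      ext w
      exact ⟨fun h => le_csSup hbdd h, fun h => (monotone_cdf α h).trans hsm⟩
    have hsu : u ≤ cdf α s := by
      have : Tendsto (cdf α) (𝓝[>] s) (𝓝 (cdf α s)) := hcont.continuousAt.tendsto.mono_left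
        nhdsWithin_le_nhds
      refine ge_of_tendsto this (eventually_nhdsWithin_of_forall fun w hw => ?_)
      by_contra! h
      exact absurd (le_csSup hbdd h.le) (not_le.2 hw)
    rw [hset, ← ofReal_cdf, le_antisymm hsm hsu]

/-- A law without atoms is transported onto any law with bounded support by a monotone map. -/
lemma exists_monotone_map_eq (α β : Measure ℝ) [IsProbabilityMeasure α] [IsProbabilityMeasure β]
    (hα : ∀ x, α {x} = 0) {M : ℝ} (hβ : β (Set.Icc (-M) M)ᶜ = 0) :
    ∃ ψ : ℝ → ℝ, Monotone ψ ∧ (∀ w, |ψ w| ≤ M) ∧ α.map ψ = β := by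
  have hM1 : ∀ y, M ≤ y → β (Set.Iic y) = 1 := fun y hy => by
    rw [prob_compl_eq_zero_iff measurableSet_Icc] at hβ
    exact le_antisymm prob_le_one (hβ ▸ measure_mono fun x hx => hx.2.trans hy)
  have hM0 : ∀ y, y < -M → β (Set.Iic y) = 0 := fun y hy =>
    measure_mono_null (t := (Set.Icc (-M) M)ᶜ)
      (fun x hx h => absurd (h.1.trans hx) (not_le.2 hy)) hβ
  have hMM : -M ≤ M := by
    by_contra! h
    rw [Set.Icc_eq_empty (not_le.2 h)] at hβ
    simp at hβ
  have hcM : cdf β M = 1 := by rw [cdf_eq_real, Measure.real, hM1 M le_rfl]; simp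
  -- `ψ` is the quantile function of `β` composed with the cdf of `α`. Restricting to `[-M, M]`
  -- keeps the infimum meaningful at level `0`, where the unrestricted set would be unbounded below.
  let S : ℝ → Set ℝ := fun u => {y ∈ Set.Icc (-M) M | u ≤ cdf β y}
  have hSM : ∀ w, M ∈ S (cdf α w) := fun w =>
    ⟨⟨hMM, le_rfl⟩, (cdf_le_one α w).trans hcM.ge⟩
  have hSb : ∀ u, BddBelow (S u) := fun u => ⟨-M, fun y hy => hy.1.1⟩
  let ψ : ℝ → ℝ := fun w => sInf (S (cdf α w))
  have hψM : ∀ w, ψ w ≤ M := fun w => csInf_le (hSb _) (hSM w)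
  have hψm : ∀ w, -M ≤ ψ w := fun w => le_csInf ⟨M, hSM w⟩ fun y hy => hy.1.1
  have hmono : Monotone ψ := fun w w' hw =>
    csInf_le_csInf (hSb _) ⟨M, hSM w'⟩ fun y hy => ⟨hy.1, (monotone_cdf α hw).trans hy.2⟩
  have hgal : ∀ w y, -M ≤ y → y < M → (ψ w ≤ y ↔ cdf α w ≤ cdf β y) := by
    intro w y hy hyM
    refine ⟨fun h => ?_, fun h => csInf_le (hSb _) ⟨⟨hy, hyM.le⟩, h⟩⟩
    refine le_trans ?_ (monotone_cdf β h)
    have hr : Tendsto (cdf β) (𝓝[>] (ψ w)) (𝓝 (cdf β (ψ w))) :=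
      ((cdf β).right_continuous (ψ w)).tendsto.mono_left (nhdsWithin_mono _ Set.Ioi_subset_Ici_self)
    refine ge_of_tendsto hr (eventually_nhdsWithin_of_forall fun z hz => ?_)
    obtain ⟨x, hx, hxz⟩ := exists_lt_of_csInf_lt ⟨M, hSM w⟩ hz
    exact hx.2.trans (monotone_cdf β hxz.le)
  refine ⟨ψ, hmono, fun w => abs_le.2 ⟨hψm w, hψM w⟩, ?_⟩
  have := Measure.isProbabilityMeasure_map (μ := α) hmono.measurable.aemeasurable
  refine Measure.ext_of_Iic _ _ fun y => ?_
  rw [Measure.map_apply hmono.measurable measurableSet_Iic]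
  rcases le_or_gt M y with hy | hy
  · have : ψ ⁻¹' Set.Iic y = Set.univ := Set.eq_univ_of_forall fun w => (hψM w).trans hy
    rw [this, hM1 y hy, measure_univ]
  rcases lt_or_ge y (-M) with hy' | hy'
  · have : ψ ⁻¹' Set.Iic y = ∅ :=
      Set.eq_empty_of_forall_notMem fun w hw => absurd ((hψm w).trans hw) (not_le.2 hy')
    rw [this, hM0 y hy', measure_empty]
  · have : ψ ⁻¹' Set.Iic y = {w | cdf α w ≤ cdf β y} := by
      ext w; exact hgal w y hy' hy
    rw [this, measure_cdf_le α hα (cdf_nonneg β y) (cdf_le_one β y), ofReal_cdf]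

end Quantile

/-! ### Monotone rearrangement and Chebyshev's inequality -/

section Rearrangement

variable {Ω : Type*} [MeasurableSpace Ω]

/-- In the presence of a random variable without atoms, the order of any random variable is refined
by that of one without atoms. -/
lemma exists_atomless_refinement {μ : Measure Ω} [IsProbabilityMeasure μ] {V g : Ω → ℝ}
    (hV : Measurable V) (hV0 : ∀ ω, 0 ≤ V ω) (hV1 : ∀ ω, V ω ≤ 1) (hVa : ∀ v, μ (V ⁻¹' {v}) = 0)
    (hg : Measurable g) :
    ∃ W : Ω → ℝ, Measurable W ∧ (∀ w, μ (W ⁻¹' {w}) = 0) ∧ ∀ ω η, g ω < g η → W ω < W η := by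
  have hfin := Measure.isProbabilityMeasure_map (μ := μ) hg.aemeasurable
  let F : ℝ → ℝ := fun x => (μ.map g).real (Set.Iic x)
  let G : ℝ → ℝ := fun x => (μ.map g).real (Set.Iio x)
  have hF : Monotone F := fun x y h => measureReal_mono (Set.Iic_subset_Iic.2 h)
  have hG : Monotone G := fun x y h => measureReal_mono (Set.Iio_subset_Iio h)
  have hGF : ∀ x, G x ≤ F x := fun x => measureReal_mono Set.Iio_subset_Iic_self
  have hFG : ∀ x y, x < y → F x ≤ G y := fun x y h =>
    measureReal_mono fun z (hz : z ≤ x) => hz.trans_lt h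
  have hatom : ∀ x, F x - G x = μ.real (g ⁻¹' {x}) := fun x => by
    have h1 : F x = G x + (μ.map g).real {x} := by
      rw [← measureReal_union (by simp) (measurableSet_singleton x)]
      simp only [F]
      congr 1
      ext z
      simp [le_iff_lt_or_eq, or_comm]
    rw [h1, map_measureReal_apply hg (measurableSet_singleton x)]
    ring
  -- Distributional transform: `V` spreads each atom of `g` over the jump of its cdf. The summand `g
  -- ω` makes the order strict even across gaps of zero mass.
  let W : Ω → ℝ := fun ω => g ω + (1 - V ω) * G (g ω) + V ω * F (g ω)
  have hord : ∀ ω η, g ω < g η → W ω < W η := by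
    intro ω η h
    have h1 := hFG _ _ h
    have h2 := mul_nonneg (hV0 η) (sub_nonneg.2 (hGF (g η)))
    have h3 := mul_nonneg (sub_nonneg.2 (hV1 ω)) (sub_nonneg.2 (hGF (g ω)))
    simp only [W]
    nlinarith
  refine ⟨W, ?_, fun w => ?_, hord⟩
  · have := hF.measurable
    have := hG.measurable
    fun_prop
  · rcases Set.eq_empty_or_nonempty (W ⁻¹' {w}) with he | ⟨ω₀, hω₀⟩
    · rw [he, measure_empty]
    have hgc : ∀ ω ∈ W ⁻¹' {w}, g ω = g ω₀ := by
      intro ω hω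
      have hWW : W ω = W ω₀ := hω.trans hω₀.symm
      rcases lt_trichotomy (g ω) (g ω₀) with h | h | h
      · exact absurd hWW (hord _ _ h).ne
      · exact h
      · exact absurd hWW (hord _ _ h).ne'
    by_cases h0 : F (g ω₀) - G (g ω₀) = 0
    · rw [hatom] at h0
      exact measure_mono_null hgc ((measureReal_eq_zero_iff).1 h0)
    · refine measure_mono_null (fun ω hω => ?_) (hVa (V ω₀))
      have hWW : W ω = W ω₀ := hω.trans hω₀.symm
      simp only [W, hgc ω hω] at hWW
      have : (V ω - V ω₀) * (F (g ω₀) - G (g ω₀)) = 0 := by linarith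
      exact sub_eq_zero.1 ((mul_eq_zero.1 this).resolve_right h0)

/-- Refine the order of `g` by an atomless `W` and transport the law of `W` monotonically onto that
of `Z`: the result increases with `W`, hence with `g`. -/
lemma exists_monovary_rearrangement {μ : Measure Ω} [IsProbabilityMeasure μ] {V g Z : Ω → ℝ}
    (hV : Measurable V) (hV0 : ∀ ω, 0 ≤ V ω) (hV1 : ∀ ω, V ω ≤ 1) (hVa : ∀ v, μ (V ⁻¹' {v}) = 0)
    (hg : Measurable g) (hZ : AEMeasurable Z μ) {M : ℝ} (hM : ∀ᵐ ω ∂μ, |Z ω| ≤ M) :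
    ∃ Y : Ω → ℝ, Measurable Y ∧ (∀ ω, |Y ω| ≤ M) ∧ μ.map Y = μ.map Z ∧ Monovary Y g := by
  obtain ⟨W, hW, hWa, hWg⟩ := exists_atomless_refinement hV hV0 hV1 hVa hg
  have h1 := Measure.isProbabilityMeasure_map (μ := μ) hW.aemeasurable
  have h2 := Measure.isProbabilityMeasure_map hZ
  obtain ⟨ψ, hψ, hψM, hmap⟩ := exists_monotone_map_eq (μ.map W) (μ.map Z) (M := M)
    (fun x => by rw [Measure.map_apply hW (measurableSet_singleton x), hWa x])
    (by
      rw [Measure.map_apply_of_aemeasurable hZ measurableSet_Icc.compl]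
      refine measure_mono_null (fun ω hω h => hω (abs_le.1 h)) hM)
  exact ⟨ψ ∘ W, hψ.measurable.comp hW, fun ω => hψM _, by
    rw [← Measure.map_map hψ.measurable hW, hmap], fun ω η h => hψ (hWg ω η h).le⟩

/-- Chebyshev's association inequality. -/
lemma integral_mul_integral_le_of_monovary {μ : Measure Ω} [IsProbabilityMeasure μ] {Y h : Ω → ℝ}
    (hY : Integrable Y μ) (hh : Integrable h μ) (hhY : Integrable (fun ω => h ω * Y ω) μ)
    (hmv : Monovary Y h) : (∫ ω, h ω ∂μ) * ∫ ω, Y ω ∂μ ≤ ∫ ω, h ω * Y ω ∂μ := by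
  have hone : Integrable (fun _ : Ω => (1 : ℝ)) μ := integrable_const 1
  have i1 := hhY.mul_prod hone
  have i2 := hone.mul_prod hhY
  have i3 := hh.mul_prod hY
  have i4 := hY.mul_prod hh
  -- Integrate `(h x - h y) * (Y x - Y y) ≥ 0` over two independent copies.
  have key : 0 ≤ ∫ z : Ω × Ω, ((h z.1 * Y z.1 * 1 + 1 * (h z.2 * Y z.2)) -
      (h z.1 * Y z.2 + Y z.1 * h z.2)) ∂(μ.prod μ) := by
    refine integral_nonneg fun z => ?_
    have : 0 ≤ (h z.1 - h z.2) * (Y z.1 - Y z.2) := by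
      rcases lt_trichotomy (h z.1) (h z.2) with hl | he | hl
      · exact mul_nonneg_of_nonpos_of_nonpos (by linarith) (by linarith [hmv hl])
      · simp [he]
      · exact mul_nonneg (by linarith) (by linarith [hmv hl])
    show (0 : ℝ) ≤ _
    linarith
  rw [integral_sub (by exact i1.add i2) (by exact i3.add i4), integral_add i1 i2,
    integral_add i3 i4,
    integral_prod_mul (fun x => h x * Y x) (fun _ => (1 : ℝ)),
    integral_prod_mul (fun _ => (1 : ℝ)) (fun x => h x * Y x), integral_prod_mul,
    integral_prod_mul] at key
  simp only [integral_const, probReal_univ, smul_eq_mul] at key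
  linarith

end Rearrangement

/-! ### Hardy–Littlewood inequality for densities of equal law -/

section HardyLittlewood

variable {Ω : Type*} [MeasurableSpace Ω] {P : Measure Ω}

lemma measure_eq_lintegral_rnDeriv_tail [IsFiniteMeasure P] {Q : Measure Ω} [IsFiniteMeasure Q]
    (hQ : Q ≪ P) (A : Set Ω) :
    Q A = ∫⁻ s in Set.Ioi (0 : ℝ), P ({ω | s < (Q.rnDeriv P ω).toReal} ∩ A) := by
  have hm : Measurable fun ω => (Q.rnDeriv P ω).toReal :=
    (Measure.measurable_rnDeriv Q P).ennreal_toReal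
  have h1 : Q A = ∫⁻ ω in A, ENNReal.ofReal (Q.rnDeriv P ω).toReal ∂P := by
    rw [← Measure.setLIntegral_rnDeriv hQ]
    refine lintegral_congr_ae (ae_restrict_of_ae ?_)
    filter_upwards [Measure.rnDeriv_ne_top Q P] with ω hω
    rw [ENNReal.ofReal_toReal hω]
  rw [h1, lintegral_eq_lintegral_meas_lt _ (ae_of_all _ fun _ => ENNReal.toReal_nonneg)
    hm.aemeasurable]
  refine lintegral_congr fun s => ?_
  rw [Measure.restrict_apply (measurableSet_lt measurable_const hm)]

/-- An upper set `B` of the density is nested with each of its superlevel sets, so the intersection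
has the smaller of the two masses. For `Q'` and `A` these masses are the same, and an intersection
never exceeds either. -/
lemma measure_le_of_identDistrib_rnDeriv [IsFiniteMeasure P] {Q Q' : Measure Ω}
    [IsFiniteMeasure Q] [IsFiniteMeasure Q'] (hQ : Q ≪ P) (hQ' : Q' ≪ P)
    (hid : IdentDistrib (Q'.rnDeriv P) (Q.rnDeriv P) P P) {A B : Set Ω} (hAB : P A = P B)
    (hup : ∀ ω ∈ B, ∀ η ∉ B, (Q.rnDeriv P η).toReal ≤ (Q.rnDeriv P ω).toReal) : Q' A ≤ Q B := by
  rw [measure_eq_lintegral_rnDeriv_tail hQ' A, measure_eq_lintegral_rnDeriv_tail hQ B]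
  refine lintegral_mono fun s => ?_
  have htail : P {ω | s < (Q'.rnDeriv P ω).toReal} = P {ω | s < (Q.rnDeriv P ω).toReal} :=
    (hid.comp ENNReal.measurable_toReal).measure_mem_eq measurableSet_Ioi
  by_cases hsub : {ω | s < (Q.rnDeriv P ω).toReal} ⊆ B
  · rw [Set.inter_eq_self_of_subset_left hsub, ← htail]
    exact measure_mono Set.inter_subset_left
  · obtain ⟨η, hη, hηB⟩ := Set.not_subset.1 hsub
    have : B ⊆ {ω | s < (Q.rnDeriv P ω).toReal} := fun ω hω => lt_of_lt_of_le hη (hup ω hω η hηB)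
    rw [Set.inter_eq_self_of_subset_right this, ← hAB]
    exact measure_mono Set.inter_subset_right

/-- A Hardy–Littlewood inequality: among all pairs with given marginal laws of the density and of
the integrand, the integral is largest for a similarly ordered pair. -/
lemma integral_le_of_monovary_rnDeriv [IsFiniteMeasure P] {Q Q' : Measure Ω}
    [IsProbabilityMeasure Q] [IsProbabilityMeasure Q'] (hQ : Q ≪ P) (hQ' : Q' ≪ P)
    (hid : IdentDistrib (Q'.rnDeriv P) (Q.rnDeriv P) P P) {Y Z : Ω → ℝ} (hY : Measurable Y)
    (hZ : Measurable Z) (hmap : P.map Y = P.map Z) {M : ℝ} (hYM : ∀ᵐ ω ∂P, |Y ω| ≤ M)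
    (hZM : ∀ᵐ ω ∂P, |Z ω| ≤ M) (hmv : Monovary Y fun ω => (Q.rnDeriv P ω).toReal) :
    ∫ ω, Z ω ∂Q' ≤ ∫ ω, Y ω ∂Q := by
  have hiY : Integrable Y Q := Integrable.of_bound hY.aestronglyMeasurable M (hQ.ae_le hYM)
  have hiZ : Integrable Z Q' := Integrable.of_bound hZ.aestronglyMeasurable M (hQ'.ae_le hZM)
  have hY0 : 0 ≤ᵐ[Q] fun ω => Y ω + M := by
    filter_upwards [hQ.ae_le hYM] with ω hω
    show 0 ≤ Y ω + M
    linarith [(abs_le.1 hω).1]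
  have hZ0 : 0 ≤ᵐ[Q'] fun ω => Z ω + M := by
    filter_upwards [hQ'.ae_le hZM] with ω hω
    show 0 ≤ Z ω + M
    linarith [(abs_le.1 hω).1]
  -- The shift by `M` permits a layer-cake decomposition of the integrands; superlevel sets of `Y`
  -- are upper sets of the density by comonotonicity.
  have hle : ∫⁻ ω, ENNReal.ofReal (Z ω + M) ∂Q' ≤ ∫⁻ ω, ENNReal.ofReal (Y ω + M) ∂Q := by
    rw [lintegral_eq_lintegral_meas_lt _ hZ0 (by fun_prop),
      lintegral_eq_lintegral_meas_lt _ hY0 (by fun_prop)]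
    refine lintegral_mono fun t => ?_
    have hset : ∀ X : Ω → ℝ, {ω | t < X ω + M} = X ⁻¹' Set.Ioi (t - M) := fun X => by
      ext ω
      simp [sub_lt_iff_lt_add]
    simp only [hset]
    refine measure_le_of_identDistrib_rnDeriv hQ hQ' hid ?_ fun ω hω η hη => ?_
    · rw [← Measure.map_apply hZ measurableSet_Ioi, ← Measure.map_apply hY measurableSet_Ioi, hmap]
    · by_contra! hlt
      exact hη (lt_of_lt_of_le hω (hmv hlt))
  have hfin : ∫⁻ ω, ENNReal.ofReal (Y ω + M) ∂Q ≠ ∞ :=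
    ((hiY.add (integrable_const M)).lintegral_lt_top).ne
  have h := ENNReal.toReal_mono hfin hle
  rw [← integral_eq_lintegral_of_nonneg_ae hZ0 (by fun_prop),
    ← integral_eq_lintegral_of_nonneg_ae hY0 (by fun_prop), integral_add hiZ (integrable_const M),
    integral_add hiY (integrable_const M)] at h
  simpa using h

end HardyLittlewood

/-! ### Lower families and their closure properties -/

section LowerFamily

variable {Ω : Type*} [MeasurableSpace Ω] {P : Measure Ω}

/-- Convex law-invariant families of essentially bounded functions that are closed downwards and
under bounded increasing limits: the sublevel sets, on the logarithmic scale, of the functionals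
under consideration. -/
structure IsLowerFamily (P : Measure Ω) (C : Set (Ω → ℝ)) : Prop where
  memLp : ∀ Y ∈ C, MemLp Y ∞ P
  down : ∀ Y ∈ C, ∀ Z, MemLp Z ∞ P → Z ≤ᵐ[P] Y → Z ∈ C
  convex : Convex ℝ C
  fromBelow : ∀ (Y : ℕ → Ω → ℝ) (Z : Ω → ℝ), (∀ n, Y n ∈ C) → MemLp Z ∞ P →
    (∀ᵐ ω ∂P, Monotone fun n => Y n ω) →
    (∀ᵐ ω ∂P, Tendsto (fun n => Y n ω) atTop (𝓝 (Z ω))) → Z ∈ C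
  law : ∀ Y ∈ C, ∀ Z, IdentDistrib Y Z P P → Z ∈ C

lemma memLp_top_of_abs_le {Y : Ω → ℝ} (hY : AEStronglyMeasurable Y P) {M : ℝ}
    (hM : ∀ᵐ ω ∂P, |Y ω| ≤ M) : MemLp Y ∞ P :=
  memLp_top_of_bound hY M hM

lemma exists_abs_le_of_memLp_top {Y : Ω → ℝ} (hY : MemLp Y ∞ P) : ∃ M, ∀ᵐ ω ∂P, |Y ω| ≤ M :=
  ⟨_, by simpa using ae_le_lpNorm_exponent_top hY⟩

/-- A closed convex set in `L²` is strictly separated from a point in its complement. -/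
lemma exists_separating_memLp_two {K : Set (Lp ℝ 2 P)} (hK : Convex ℝ K) (hKc : IsClosed K)
    {Z : Lp ℝ 2 P} (hZ : Z ∉ K) :
    ∃ (h : Ω → ℝ) (u : ℝ), Measurable h ∧ MemLp h 2 P ∧ (∀ y ∈ K, ∫ ω, h ω * y ω ∂P < u) ∧
      u < ∫ ω, h ω * Z ω ∂P := by
  obtain ⟨φ, u, hφ, hφZ⟩ := geometric_hahn_banach_closed_point hK hKc hZ
  let h := (InnerProductSpace.toDual ℝ (Lp ℝ 2 P)).symm φ
  have hrep : ∀ y : Lp ℝ 2 P, φ y = ∫ ω, h ω * y ω ∂P := fun y => by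
    rw [← InnerProductSpace.toDual_symm_apply, L2.inner_def]
    simp [h, mul_comm]
  refine ⟨h, u, (Lp.stronglyMeasurable h).measurable, Lp.memLp h, fun y hy => ?_, ?_⟩
  · rw [← hrep]; exact hφ y hy
  · rw [← hrep]; exact hφZ

variable {C : Set (Ω → ℝ)}

lemma IsLowerFamily.congr (hC : IsLowerFamily P C) {Y Z : Ω → ℝ} (hY : Y ∈ C) (h : Y =ᵐ[P] Z) :
    Z ∈ C :=
  hC.down Y hY Z ((hC.memLp Y hY).ae_eq h) h.symm.le

lemma IsLowerFamily.mem_of_forall_sub_mem (hC : IsLowerFamily P C) {Z : Ω → ℝ}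
    (hZ : MemLp Z ∞ P) {c : ℝ} (hc : 0 ≤ c) (h : ∀ n : ℕ, (fun ω => Z ω - c / (n + 1)) ∈ C) :
    Z ∈ C := by
  refine hC.fromBelow (fun n ω => Z ω - c / (n + 1)) Z h hZ (ae_of_all _ fun ω => ?_)
    (ae_of_all _ fun ω => ?_)
  · intro n m hnm
    show Z ω - c / (n + 1) ≤ Z ω - c / (m + 1)
    gcongr
  · have := (tendsto_const_div_atTop_nhds_zero_nat c).comp (tendsto_add_atTop_nat 1)
    have h2 := (tendsto_const_nhds (x := Z ω)).sub this
    simpa using h2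

/-- A lower family is closed under bounded almost sure limits. -/
lemma IsLowerFamily.mem_of_tendsto_ae (hC : IsLowerFamily P C) {Y : ℕ → Ω → ℝ} {Z : Ω → ℝ}
    {M : ℝ} (hY : ∀ n, Y n ∈ C) (hM : ∀ n, ∀ᵐ ω ∂P, |Y n ω| ≤ M)
    (hlim : ∀ᵐ ω ∂P, Tendsto (fun n => Y n ω) atTop (𝓝 (Z ω))) : Z ∈ C := by
  have hYm : ∀ n, AEMeasurable (Y n) P := fun n =>
    (hC.memLp _ (hY n)).aestronglyMeasurable.aemeasurable
  have hall : ∀ᵐ ω ∂P, ∀ n, |Y n ω| ≤ M := ae_all_iff.2 hM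
  have hZm : AEStronglyMeasurable Z P :=
    aestronglyMeasurable_of_tendsto_ae _ (fun n => (hYm n).aestronglyMeasurable) hlim
  have hZM : MemLp Z ∞ P := memLp_top_of_abs_le hZm (M := M) (by
    filter_upwards [hlim, hall] with ω h1 h2
    exact le_of_tendsto' h1.abs h2)
  have hb : ∀ ω, (∀ n, |Y n ω| ≤ M) → ∀ n, BddBelow (Set.range fun k => Y (n + k) ω) :=
    fun ω hω n => ⟨-M, by rintro _ ⟨k, rfl⟩; exact (abs_le.1 (hω _)).1⟩
  -- Tail infima lie below `Y n` and increase to the limit.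
  refine hC.fromBelow (fun n ω => ⨅ k, Y (n + k) ω) Z (fun n => ?_) hZM ?_ ?_
  · refine hC.down (Y n) (hY n) _ (memLp_top_of_abs_le (M := M) ?_ ?_) ?_
    · exact (AEMeasurable.iInf fun k => hYm (n + k)).aestronglyMeasurable
    · filter_upwards [hall] with ω hω
      refine abs_le.2 ⟨le_ciInf fun k => (abs_le.1 (hω _)).1, ?_⟩
      exact (ciInf_le (hb ω hω n) 0).trans (abs_le.1 (hω _)).2
    · filter_upwards [hall] with ω hω
      exact ciInf_le (hb ω hω n) 0
  · filter_upwards [hall] with ω hω n m hnm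
    refine le_ciInf fun k => ?_
    have := ciInf_le (hb ω hω n) (m - n + k)
    rwa [← add_assoc, Nat.add_sub_cancel' hnm] at this
  · filter_upwards [hall, hlim] with ω hω hl
    refine Metric.tendsto_atTop.2 fun ε hε => ?_
    obtain ⟨N, hN⟩ := Metric.tendsto_atTop.1 hl (ε / 2) (half_pos hε)
    refine ⟨N, fun n hn => ?_⟩
    have hN' : ∀ k, |Y (n + k) ω - Z ω| < ε / 2 := fun k => hN (n + k) (by omega)
    have h1 : Z ω - ε / 2 ≤ ⨅ k, Y (n + k) ω := le_ciInf fun k => by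
      linarith [(abs_lt.1 (hN' k)).1]
    have h2 := ciInf_le (hb ω hω n) 0
    have h3 := (abs_lt.1 (hN' 0)).2
    rw [Real.dist_eq, abs_lt]
    constructor <;> linarith

lemma IsLowerFamily.convex_Lp_two (hC : IsLowerFamily P C) :
    Convex ℝ {y : Lp ℝ 2 P | (y : Ω → ℝ) ∈ C} := by
  intro x hx y hy a b ha hb hab
  refine hC.congr (hC.convex hx hy ha hb hab) ?_
  filter_upwards [Lp.coeFn_add (a • x) (b • y), Lp.coeFn_smul a x, Lp.coeFn_smul b y]
    with ω h1 h2 h3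
  rw [h1, Pi.add_apply, Pi.add_apply, h2, h3]

lemma convex_Lp_two_abs_le (M : ℝ) : Convex ℝ {y : Lp ℝ 2 P | ∀ᵐ ω ∂P, |y ω| ≤ M} := by
  intro x hx y hy a b ha hb hab
  change ∀ᵐ ω ∂P, |(a • x + b • y) ω| ≤ M
  filter_upwards [Lp.coeFn_add (a • x) (b • y), Lp.coeFn_smul a x, Lp.coeFn_smul b y, hx, hy]
    with ω h1 h2 h3 h4 h5
  rw [h1, Pi.add_apply, h2, h3, Pi.smul_apply, Pi.smul_apply, smul_eq_mul, smul_eq_mul]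
  have := abs_add_le (a * x ω) (b * y ω)
  rw [abs_mul, abs_mul, abs_of_nonneg ha, abs_of_nonneg hb] at this
  have h6 := mul_le_mul_of_nonneg_left h4 ha
  have h7 := mul_le_mul_of_nonneg_left h5 hb
  have h8 : a * M + b * M = M := by rw [← add_mul, hab, one_mul]
  linarith

/-- An `L²` limit is an almost sure limit along a subsequence; the common bound `M` is what lets
closure under bounded limits apply. -/
lemma IsLowerFamily.isClosed_Lp_two_abs_le (hC : IsLowerFamily P C) (M : ℝ) :
    IsClosed ({y : Lp ℝ 2 P | (y : Ω → ℝ) ∈ C} ∩ {y : Lp ℝ 2 P | ∀ᵐ ω ∂P, |y ω| ≤ M}) := by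
  refine IsSeqClosed.isClosed fun y z hy hz => ?_
  have hmeas : TendstoInMeasure P (fun n => (y n : Ω → ℝ)) atTop z :=
    tendstoInMeasure_of_tendsto_Lp hz
  obtain ⟨ns, -, hns⟩ := hmeas.exists_seq_tendsto_ae
  refine ⟨hC.mem_of_tendsto_ae (fun n => (hy (ns n)).1) (fun n => (hy (ns n)).2) hns, ?_⟩
  have hall : ∀ᵐ ω ∂P, ∀ n, |y (ns n) ω| ≤ M := ae_all_iff.2 fun n => (hy (ns n)).2
  filter_upwards [hall, hns] with ω h1 h2
  exact le_of_tendsto' h2.abs h1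

end LowerFamily

/-! ### Stability under averaging over partitions -/

section Partition

variable {Ω : Type*} [MeasurableSpace Ω] {P : Measure Ω}

/-- The conditional expectation with respect to the partition into the level sets of `d`. -/
noncomputable def cellAverage (P : Measure Ω) (d : Ω → ℤ) (Y : Ω → ℝ) (ω : Ω) : ℝ :=
  ∫ x, Y x ∂P[|d ⁻¹' {d ω}]

lemma setIntegral_eq_mul_integral_cond [IsFiniteMeasure P] (A : Set Ω) (f : Ω → ℝ) :
    ∫ x in A, f x ∂P = P.real A * ∫ x, f x ∂P[|A] := by
  by_cases h0 : P A = 0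
  · rw [setIntegral_measure_zero f h0, Measure.real, h0]; simp
  · rw [ProbabilityTheory.cond, integral_smul_measure, ENNReal.toReal_inv, smul_eq_mul,
      ← Measure.real, mul_inv_cancel_left₀]
    exact (measureReal_ne_zero_iff).2 h0

lemma hasSum_integral_cond [IsFiniteMeasure P] {d : Ω → ℤ} (hd : Measurable d) {f : Ω → ℝ}
    (hf : Integrable f P) :
    HasSum (fun i => P.real (d ⁻¹' {i}) * ∫ x, f x ∂P[|d ⁻¹' {i}]) (∫ x, f x ∂P) := by
  have h := hasSum_integral_iUnion (μ := P) (f := f) (s := fun i : ℤ => d ⁻¹' {i})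
    (fun i => hd (measurableSet_singleton i))
    (fun i j hij => (Set.disjoint_singleton.2 hij).preimage d) hf.integrableOn
  rw [← Set.preimage_iUnion, Set.iUnion_of_singleton, Set.preimage_univ, setIntegral_univ] at h
  simpa only [setIntegral_eq_mul_integral_cond] using h

lemma measurable_cellAverage {d : Ω → ℤ} (hd : Measurable d) (Y : Ω → ℝ) :
    Measurable (cellAverage P d Y) :=
  (measurable_of_countable fun i : ℤ => ∫ x, Y x ∂P[|d ⁻¹' {i}]).comp hd

lemma abs_cellAverage_le {d : Ω → ℤ} [IsFiniteMeasure P] {Y : Ω → ℝ} {M : ℝ} (hM0 : 0 ≤ M)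
    (hM : ∀ᵐ ω ∂P, |Y ω| ≤ M) (ω : Ω) : |cellAverage P d Y ω| ≤ M := by
  have h := norm_integral_le_of_norm_le_const (μ := P[|d ⁻¹' {d ω}]) (f := Y) (C := M)
    (cond_absolutelyContinuous.ae_le hM)
  refine h.trans ?_
  by_cases h0 : P (d ⁻¹' {d ω}) = 0
  · rw [cond_eq_zero_of_meas_eq_zero h0]; simpa
  · have := cond_isProbabilityMeasure h0
    simp

lemma ae_cell_ne_zero [IsFiniteMeasure P] (d : Ω → ℤ) : ∀ᵐ ω ∂P, P (d ⁻¹' {d ω}) ≠ 0 := by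
  refine measure_mono_null (t := ⋃ i ∈ {i | P (d ⁻¹' {i}) = 0}, d ⁻¹' {i}) (fun ω hω => ?_)
    ((measure_biUnion_null_iff (Set.to_countable _)).2 fun i hi => hi)
  simp only [Set.mem_compl_iff, Set.mem_ofPred_eq, not_not] at hω
  exact Set.mem_biUnion (x := d ω) hω rfl

lemma integrable_cond [IsFiniteMeasure P] {f : Ω → ℝ} (hf : Integrable f P) (A : Set Ω) :
    Integrable f P[|A] := by
  by_cases h0 : P A = 0
  · rw [cond_eq_zero_of_meas_eq_zero h0]; exact integrable_zero_measure
  · exact hf.integrableOn.smul_measure (ENNReal.inv_ne_top.2 h0)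

/-- Rearranging within the cells of a partition so as to be ordered like `h` in each cell. -/
lemma exists_cellwise_rearrangement [IsProbabilityMeasure P] (hP : IsNonatomic P) {d : Ω → ℤ}
    (hd : Measurable d) {h Y : Ω → ℝ} (hh : Measurable h) (hY : AEMeasurable Y P) {M : ℝ}
    (hM0 : 0 ≤ M) (hM : ∀ᵐ ω ∂P, |Y ω| ≤ M) :
    ∃ Y' : ℤ → Ω → ℝ, (∀ i, Measurable (Y' i)) ∧ (∀ i ω, |Y' i ω| ≤ M) ∧
      (∀ i, Monovary (Y' i) h) ∧ (∀ i, (P[|d ⁻¹' {i}]).map (Y' i) = (P[|d ⁻¹' {i}]).map Y) ∧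
      IdentDistrib Y (fun ω => Y' (d ω) ω) P P := by
  obtain ⟨V, hV, hV0, hV1, hVa⟩ := hP.exists_atomless
  have hex : ∀ i, ∃ Y' : Ω → ℝ, Measurable Y' ∧ (∀ ω, |Y' ω| ≤ M) ∧ Monovary Y' h ∧
      (P[|d ⁻¹' {i}]).map Y' = (P[|d ⁻¹' {i}]).map Y := by
    intro i
    by_cases h0 : P (d ⁻¹' {i}) = 0
    · exact ⟨fun _ => 0, measurable_const, fun _ => by simpa using hM0, fun _ _ _ => le_rfl, by
        rw [cond_eq_zero_of_meas_eq_zero h0]; simp⟩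
    · have := cond_isProbabilityMeasure h0
      have hac : P[|d ⁻¹' {i}] ≪ P := cond_absolutelyContinuous
      obtain ⟨Y', h1, h2, h3, h4⟩ := exists_monovary_rearrangement (μ := P[|d ⁻¹' {i}]) hV hV0 hV1
        (fun v => hac (hVa v)) hh (hY.mono_ac hac) (hac.ae_le hM)
      exact ⟨Y', h1, h2, h4, h3⟩
  choose Y' h1 h2 h3 h4 using hex
  have hglue : Measurable fun ω => Y' (d ω) ω :=
    (measurable_from_prod_countable_right (f := fun z : ℤ × Ω => Y' z.1 z.2) h1).comp
      (hd.prodMk measurable_id)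
  refine ⟨Y', h1, h2, h3, h4, hY, hglue.aemeasurable, ?_⟩
  ext S hS
  rw [Measure.map_apply_of_aemeasurable hY hS, Measure.map_apply hglue hS]
  have hsplit : ∀ T : Set Ω, NullMeasurableSet T P →
      P T = ∑' i, P (d ⁻¹' {i}) * P[|d ⁻¹' {i}] T := by
    intro T hT
    have hu : T = ⋃ i, d ⁻¹' {i} ∩ T := by
      ext ω; simp
    conv_lhs => rw [hu]
    rw [measure_iUnion₀]
    · refine tsum_congr fun i => ?_
      rw [mul_comm, cond_mul_eq_inter (hd (measurableSet_singleton i))]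
    · intro i j hij
      exact (((Set.disjoint_singleton.2 hij).preimage d).mono Set.inter_subset_left
        Set.inter_subset_left).aedisjoint
    · exact fun i => (hd (measurableSet_singleton i)).nullMeasurableSet.inter hT
  rw [hsplit _ (hY.nullMeasurableSet_preimage hS), hsplit _ (hglue hS).nullMeasurableSet]
  refine tsum_congr fun i => ?_
  congr 1
  have hac : P[|d ⁻¹' {i}] ≪ P := cond_absolutelyContinuous
  rw [← Measure.map_apply_of_aemeasurable (hY.mono_ac hac) hS, ← h4 i,
    Measure.map_apply (h1 i) hS]
  refine measure_congr ?_
  have : ∀ᵐ ω ∂P[|d ⁻¹' {i}], d ω = i := ae_cond_mem (hd (measurableSet_singleton i))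
  filter_upwards [this] with ω hω
  simp only [eq_iff_iff]
  show Y' i ω ∈ S ↔ Y' (d ω) ω ∈ S
  rw [hω]

/-- A lower family on a non-atomic space is closed under conditional expectations with respect to
countable partitions. -/
lemma IsLowerFamily.cellAverage_mem [IsProbabilityMeasure P] (hP : IsNonatomic P)
    {C : Set (Ω → ℝ)} (hC : IsLowerFamily P C) {d : Ω → ℤ} (hd : Measurable d) {Y : Ω → ℝ}
    (hY : Y ∈ C) : cellAverage P d Y ∈ C := by
  obtain ⟨M', hM'⟩ := exists_abs_le_of_memLp_top (hC.memLp Y hY)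
  set M := max M' 0
  have hM0 : 0 ≤ M := le_max_right _ _
  have hM : ∀ᵐ ω ∂P, |Y ω| ≤ M := hM'.mono fun ω h => h.trans (le_max_left _ _)
  have hYm : AEMeasurable Y P := (hC.memLp Y hY).aestronglyMeasurable.aemeasurable
  have havm := measurable_cellAverage (P := P) hd Y
  have havM := abs_cellAverage_le (d := d) hM0 hM
  have hav2 : MemLp (cellAverage P d Y) 2 P :=
    (memLp_top_of_abs_le havm.aestronglyMeasurable (ae_of_all _ havM)).mono_exponent le_top
  by_contra hnot
  have hnotK : hav2.toLp _ ∉ {y : Lp ℝ 2 P | (y : Ω → ℝ) ∈ C} ∩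
      {y : Lp ℝ 2 P | ∀ᵐ ω ∂P, |y ω| ≤ M} :=
    fun h => hnot (hC.congr h.1 hav2.coeFn_toLp)
  obtain ⟨h, u, hhm, hh2, hlt, hgt⟩ := exists_separating_memLp_two
    (hC.convex_Lp_two.inter (convex_Lp_two_abs_le M)) (hC.isClosed_Lp_two_abs_le M) hnotK
  -- The glued rearrangement has the law of `Y` and the bound `M`, so it lies on the family's side
  -- of the separation; Chebyshev in each cell contradicts this.
  obtain ⟨Y', h1, h2, h3, h4, h5⟩ := exists_cellwise_rearrangement hP hd hhm hYm hM0 hM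
  have hZC := hC.law Y hY _ h5
  have hZ2 : MemLp (fun ω => Y' (d ω) ω) 2 P := (hC.memLp _ hZC).mono_exponent le_top
  have hltZ := hlt (hZ2.toLp _) ⟨hC.congr hZC hZ2.coeFn_toLp.symm, by
    show ∀ᵐ ω ∂P, |hZ2.toLp _ ω| ≤ M
    filter_upwards [hZ2.coeFn_toLp] with ω hω
    rw [hω]; exact h2 _ _⟩
  have e1 : ∫ ω, h ω * hZ2.toLp _ ω ∂P = ∫ ω, h ω * Y' (d ω) ω ∂P :=
    integral_congr_ae (hZ2.coeFn_toLp.mono fun ω hω => by simp only [hω])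
  have e2 : ∫ ω, h ω * hav2.toLp _ ω ∂P = ∫ ω, h ω * cellAverage P d Y ω ∂P :=
    integral_congr_ae (hav2.coeFn_toLp.mono fun ω hω => by simp only [hω])
  rw [e1] at hltZ
  rw [e2] at hgt
  have hh1 : Integrable h P := hh2.integrable (by norm_num)
  have hiZ : Integrable (fun ω => h ω * Y' (d ω) ω) P := hh2.integrable_mul hZ2
  have hiA : Integrable (fun ω => h ω * cellAverage P d Y ω) P := hh2.integrable_mul hav2
  refine absurd (hltZ.trans hgt) (not_lt.2 ?_)
  refine hasSum_le (fun i => ?_) (hasSum_integral_cond hd hiA) (hasSum_integral_cond hd hiZ)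
  by_cases h0 : P (d ⁻¹' {i}) = 0
  · simp [Measure.real, h0]
  refine mul_le_mul_of_nonneg_left ?_ measureReal_nonneg
  have := cond_isProbabilityMeasure h0
  have hcell : ∀ᵐ ω ∂P[|d ⁻¹' {i}], d ω = i := ae_cond_mem (hd (measurableSet_singleton i))
  have hac : P[|d ⁻¹' {i}] ≪ P := cond_absolutelyContinuous
  have eA : ∫ ω, h ω * cellAverage P d Y ω ∂P[|d ⁻¹' {i}] =
      (∫ ω, h ω ∂P[|d ⁻¹' {i}]) * ∫ ω, Y' i ω ∂P[|d ⁻¹' {i}] := by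
    have hmean : ∫ ω, Y' i ω ∂P[|d ⁻¹' {i}] = ∫ ω, Y ω ∂P[|d ⁻¹' {i}] :=
      (IdentDistrib.mk (h1 i).aemeasurable (hYm.mono_ac hac) (h4 i)).integral_eq
    rw [hmean, ← integral_mul_const]
    refine integral_congr_ae (hcell.mono fun ω hω => ?_)
    simp only [cellAverage, hω]
  have eZ : ∫ ω, h ω * Y' (d ω) ω ∂P[|d ⁻¹' {i}] = ∫ ω, h ω * Y' i ω ∂P[|d ⁻¹' {i}] :=
    integral_congr_ae (hcell.mono fun ω hω => by simp only [hω])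
  rw [eA, eZ]
  have hiY : Integrable (Y' i) P[|d ⁻¹' {i}] :=
    Integrable.of_bound (h1 i).aestronglyMeasurable M (ae_of_all _ (h2 i))
  refine integral_mul_integral_le_of_monovary hiY (integrable_cond hh1 _) ?_ (h3 i)
  exact (integrable_cond hiZ _).congr (hcell.mono fun ω hω => by simp only [hω])

end Partition

/-! ### Separation by an absolutely continuous probability -/

section Separation

variable {Ω : Type*} [MeasurableSpace Ω] {P : Measure Ω} {C : Set (Ω → ℝ)}

lemma exists_pos_le_measureReal_cell [IsFiniteMeasure P] {d : Ω → ℤ}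
    (hfin : (Set.range d).Finite) :
    ∃ p : ℝ, 0 < p ∧ ∀ i, P (d ⁻¹' {i}) ≠ 0 → p ≤ P.real (d ⁻¹' {i}) := by
  have hS : {i | P (d ⁻¹' {i}) ≠ 0}.Finite := by
    refine hfin.subset fun i hi => ?_
    by_contra h
    refine hi ?_
    rw [Set.preimage_singleton_eq_empty.2 h, measure_empty]
  rcases Set.eq_empty_or_nonempty {i | P (d ⁻¹' {i}) ≠ 0} with he | hne
  · exact ⟨1, one_pos, fun i hi => absurd hi (Set.eq_empty_iff_forall_notMem.1 he i)⟩
  · obtain ⟨j, hj, hmin⟩ := Set.exists_min_image _ (fun i => P.real (d ⁻¹' {i})) hS hne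
    exact ⟨_, measureReal_nonneg.lt_of_ne' ((measureReal_ne_zero_iff).2 hj), hmin⟩

/-- A simple function that is not in a lower family even after subtraction of a positive constant
has positive distance from the family in `L¹`. -/
lemma IsLowerFamily.exists_le_integral_abs_sub [IsProbabilityMeasure P] (hP : IsNonatomic P)
    (hC : IsLowerFamily P C)
    {d : Ω → ℤ} (hd : Measurable d) (hfin : (Set.range d).Finite) {φ : ℤ → ℝ} {ε : ℝ}
    (hε : 0 < ε) (hφ : MemLp (fun ω => φ (d ω)) ∞ P) (hnot : (fun ω => φ (d ω) - ε) ∉ C) :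
    ∃ δ : ℝ, 0 < δ ∧ ∀ Y ∈ C, δ ≤ ∫ ω, |Y ω - φ (d ω)| ∂P := by
  obtain ⟨p, hp, hpi⟩ := exists_pos_le_measureReal_cell (P := P) hfin
  -- An `L¹` error below `p * ε` moves the mean over a cell of mass at least `p` by less than `ε`.
  -- The cell average of `Y` would then dominate `φ ∘ d - ε`.
  refine ⟨p * ε, mul_pos hp hε, fun Y hY => ?_⟩
  by_contra! hlt
  have hYi : Integrable Y P := (hC.memLp Y hY).integrable le_top
  have hφi : Integrable (fun ω => φ (d ω)) P := hφ.integrable le_top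
  refine hnot (hC.down _ (hC.cellAverage_mem hP hd hY) _ (hφ.sub (memLp_const ε)) ?_)
  filter_upwards [ae_cell_ne_zero d] with ω hω
  have := cond_isProbabilityMeasure hω
  set A := d ⁻¹' {d ω} with hA
  have hAm : MeasurableSet A := hd (measurableSet_singleton _)
  have h1 : ∫ x in A, (φ (d x) - Y x) ∂P = P.real A * (φ (d ω) - cellAverage P d Y ω) := by
    rw [setIntegral_eq_mul_integral_cond, integral_sub (integrable_cond hφi _)
      (integrable_cond hYi _)]
    congr 2
    have hcell : ∀ᵐ x ∂P[|A], d x = d ω := ae_cond_mem hAm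
    rw [integral_congr_ae (g := fun _ => φ (d ω)) (hcell.mono fun x hx => by simp only [hx])]
    simp
  have h2 : ∫ x in A, (φ (d x) - Y x) ∂P ≤ ∫ x, |Y x - φ (d x)| ∂P := by
    refine le_trans (integral_mono (hφi.sub hYi).integrableOn (hYi.sub hφi).abs.integrableOn
      fun x => ?_) (setIntegral_le_integral (hYi.sub hφi).abs (ae_of_all _ fun x => abs_nonneg _))
    show φ (d x) - Y x ≤ |Y x - φ (d x)|
    rw [abs_sub_comm]
    exact le_abs_self _
  have h3 := hpi (d ω) hω
  have h4 : P.real A * (φ (d ω) - cellAverage P d Y ω) < P.real A * ε := by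
    rw [← h1]
    exact h2.trans_lt (hlt.trans_le (mul_le_mul_of_nonneg_right h3 hε.le))
  have h5 := lt_of_mul_lt_mul_left h4 measureReal_nonneg
  show φ (d ω) - ε ≤ cellAverage P d Y ω
  linarith

lemma integral_abs_le_norm_Lp_two [IsProbabilityMeasure P] (y : Lp ℝ 2 P) : ∫ ω, |y ω| ∂P ≤ ‖y‖ := by
  have h1 : eLpNorm y 1 P ≤ eLpNorm y 2 P :=
    eLpNorm_le_eLpNorm_of_exponent_le (by norm_num) (Lp.aestronglyMeasurable y)
  have h2 : ∫ ω, |y ω| ∂P = (eLpNorm y 1 P).toReal := by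
    rw [eLpNorm_one_eq_lintegral_enorm, ← integral_norm_eq_lintegral_enorm
      (Lp.aestronglyMeasurable y)]
    rfl
  rw [h2, Lp.norm_def]
  exact ENNReal.toReal_mono (Lp.eLpNorm_ne_top y) h1

/-- A functional bounded above on a nonempty lower family is nonnegative. -/
lemma IsLowerFamily.nonneg_of_bounded_above (hC : IsLowerFamily P C) (hne : C.Nonempty)
    {h : Ω → ℝ} (hm : Measurable h) (hh : Integrable h P) {u : ℝ}
    (hu : ∀ Y ∈ C, ∫ ω, h ω * Y ω ∂P < u) : 0 ≤ᵐ[P] h := by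
  obtain ⟨Y₀, hY₀⟩ := hne
  have hA : MeasurableSet {ω | h ω < 0} := measurableSet_lt hm measurable_const
  set I : Ω → ℝ := {ω | h ω < 0}.indicator fun _ => 1 with hI
  have hIm : Measurable I := measurable_const.indicator hA
  have hI01 : ∀ ω, 0 ≤ I ω ∧ I ω ≤ 1 := fun ω => by
    by_cases hω : h ω < 0 <;> simp [hI, hω]
  have hIt : MemLp I ∞ P := memLp_top_of_abs_le (M := 1) hIm.aestronglyMeasurable
    (ae_of_all _ fun ω => abs_le.2 ⟨by linarith [(hI01 ω).1], (hI01 ω).2⟩)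
  have hhI : ∀ ω, h ω * I ω ≤ 0 := fun ω => by
    by_cases hω : h ω < 0 <;> simp [hI, hω]
    exact hω.le
  have i1 : Integrable (fun ω => h ω * Y₀ ω) P := hh.mul_of_top_left (hC.memLp _ hY₀)
  have i2 : Integrable (fun ω => h ω * I ω) P := hh.mul_of_top_left hIt
  set c := ∫ ω, h ω * I ω ∂P with hc
  have hc0 : c ≤ 0 := integral_nonpos hhI
  have hceq : c = 0 := by
    by_contra hcne
    have hcneg : c < 0 := lt_of_le_of_ne hc0 hcne
    -- This `t` makes the integral of `h * (Y₀ - t * I)` exactly `u`, violating the strict bound.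
    set t := (u - ∫ ω, h ω * Y₀ ω ∂P) / (-c) with ht
    have ht0 : 0 ≤ t := div_nonneg (sub_nonneg.2 (hu _ hY₀).le) (neg_nonneg.2 hc0)
    have hmem : (fun ω => Y₀ ω - t * I ω) ∈ C := by
      refine hC.down _ hY₀ _ ((hC.memLp _ hY₀).sub (hIt.const_mul t)) (ae_of_all _ fun ω => ?_)
      show Y₀ ω - t * I ω ≤ Y₀ ω
      linarith [mul_nonneg ht0 (hI01 ω).1]
    have hlt := hu _ hmem
    have : ∫ ω, h ω * (Y₀ ω - t * I ω) ∂P = (∫ ω, h ω * Y₀ ω ∂P) - t * c := by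
      rw [hc, ← integral_const_mul, ← integral_sub i1 (i2.const_mul t)]
      refine integral_congr_ae (ae_of_all _ fun ω => ?_)
      show h ω * (Y₀ ω - t * I ω) = h ω * Y₀ ω - t * (h ω * I ω)
      ring
    rw [this, ht, div_mul_eq_mul_div, div_neg, mul_div_assoc, div_self hcne] at hlt
    linarith
  have h0 : (fun ω => -(h ω * I ω)) =ᵐ[P] 0 := by
    rw [← integral_eq_zero_iff_of_nonneg (fun ω => neg_nonneg.2 (hhI ω)) i2.neg, integral_neg,
      ← hc, hceq, neg_zero]
  filter_upwards [h0] with ω hω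
  by_contra hneg
  have hneg' : h ω < 0 := not_le.1 hneg
  simp [hI, hneg'] at hω
  exact hneg'.ne hω

lemma exists_absContProb_integral_eq {h : Ω → ℝ} (hm : Measurable h) (hh : Integrable h P)
    (h0 : 0 ≤ᵐ[P] h) (hpos : 0 < ∫ ω, h ω ∂P) :
    ∃ Q : AbsContProb P, ∀ Y : Ω → ℝ, ∫ ω, Y ω ∂Q.1 = (∫ ω, h ω ∂P)⁻¹ * ∫ ω, h ω * Y ω ∂P := by
  set c := ∫ ω, h ω ∂P with hc
  let D : Ω → ℝ≥0∞ := fun ω => ENNReal.ofReal (c⁻¹ * h ω)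
  have hD : Measurable D := (hm.const_mul _).ennreal_ofReal
  have hcD : 0 ≤ᵐ[P] fun ω => c⁻¹ * h ω :=
    h0.mono fun ω hω => mul_nonneg (inv_nonneg.2 hpos.le) hω
  have hone : ∫⁻ ω, D ω ∂P = 1 := by
    rw [← ofReal_integral_eq_lintegral_ofReal (hh.const_mul _) hcD, integral_const_mul, ← hc,
      inv_mul_cancel₀ hpos.ne', ENNReal.ofReal_one]
  refine ⟨⟨P.withDensity D, ⟨by
    rw [withDensity_apply _ MeasurableSet.univ, setLIntegral_univ, hone]⟩,
    withDensity_absolutelyContinuous _ _⟩, fun Y => ?_⟩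
  show ∫ ω, Y ω ∂(P.withDensity D) = _
  rw [integral_withDensity_eq_integral_toReal_smul hD (ae_of_all _ fun _ => ENNReal.ofReal_lt_top),
    ← integral_const_mul]
  refine integral_congr_ae ?_
  filter_upwards [hcD] with ω hω
  have hω' : 0 ≤ c⁻¹ * h ω := hω
  simp only [D, ENNReal.toReal_ofReal hω', smul_eq_mul]
  ring

/-- Every bounded function outside a lower family is strictly separated from it by an absolutely
continuous probability measure. -/
theorem IsLowerFamily.exists_integral_lt [IsProbabilityMeasure P] (hP : IsNonatomic P)
    (hC : IsLowerFamily P C)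
    {Z : Ω → ℝ} (hZm : Measurable Z) {M : ℝ} (hZM : ∀ ω, |Z ω| ≤ M) (hZ : Z ∉ C) :
    ∃ Q : AbsContProb P, ∀ Y ∈ C, ∫ ω, Y ω ∂Q.1 < ∫ ω, Z ω ∂Q.1 := by
  rcases Set.eq_empty_or_nonempty C with rfl | hne
  · exact ⟨⟨P, inferInstance, Measure.AbsolutelyContinuous.rfl⟩, fun Y hY => hY.elim⟩
  have hZt : MemLp Z ∞ P := memLp_top_of_abs_le hZm.aestronglyMeasurable (ae_of_all _ hZM)
  -- Of the margin `2 / (n + 1)`, one half pays for rounding `Z` down to the grid; the other is the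
  -- `ε` of the distance estimate.
  obtain ⟨n, hn⟩ : ∃ n : ℕ, (fun ω => Z ω - 2 / (n + 1)) ∉ C := by
    by_contra! hall
    exact hZ (hC.mem_of_forall_sub_mem hZt zero_le_two hall)
  have hn0 : (0 : ℝ) < n + 1 := by positivity
  let d : Ω → ℤ := fun ω => ⌊(n + 1) * Z ω⌋
  let φ : ℤ → ℝ := fun i => i / (n + 1)
  have hd : Measurable d := Int.measurable_floor.comp (hZm.const_mul _)
  have hfin : (Set.range d).Finite := by
    refine (Set.finite_Icc ⌊-((n + 1) * M)⌋ ⌊(n + 1) * M⌋).subset ?_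
    rintro _ ⟨ω, rfl⟩
    have := abs_le.1 (hZM ω)
    constructor
    · refine Int.floor_le_floor ?_
      rw [← mul_neg]
      exact mul_le_mul_of_nonneg_left this.1 hn0.le
    · exact Int.floor_le_floor (mul_le_mul_of_nonneg_left this.2 hn0.le)
  have hφle : ∀ ω, φ (d ω) ≤ Z ω := fun ω => by
    rw [div_le_iff₀ hn0, mul_comm]
    exact Int.floor_le _
  have hφge : ∀ ω, Z ω - 1 / (n + 1) ≤ φ (d ω) := fun ω => by
    rw [le_div_iff₀ hn0, sub_mul, div_mul_cancel₀ _ hn0.ne', mul_comm]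
    exact (Int.sub_one_lt_floor _).le
  have h1n : 1 / ((n : ℝ) + 1) ≤ 1 := by
    rw [div_le_one hn0]
    exact le_add_of_nonneg_left (Nat.cast_nonneg n)
  have hφt : MemLp (fun ω => φ (d ω)) ∞ P :=
    memLp_top_of_abs_le (M := M + 1)
      ((measurable_of_countable φ).comp hd).aestronglyMeasurable (ae_of_all _ fun ω => by
        have := abs_le.1 (hZM ω)
        exact abs_le.2 ⟨by linarith [hφge ω], by linarith [hφle ω]⟩)
  have hφnot : (fun ω => φ (d ω) - 1 / ((n : ℝ) + 1)) ∉ C := fun hmem => by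
    refine hn (hC.down _ hmem _ (hZt.sub (memLp_const _)) (ae_of_all _ fun ω => ?_))
    show Z ω - 2 / (n + 1) ≤ φ (d ω) - 1 / (n + 1)
    have : (2 : ℝ) / (n + 1) = 1 / (n + 1) + 1 / (n + 1) := by ring
    linarith [hφge ω]
  obtain ⟨δ, hδ, hdist⟩ := hC.exists_le_integral_abs_sub hP hd hfin (by positivity) hφt hφnot
  have hφ2 : MemLp (fun ω => φ (d ω)) 2 P := hφt.mono_exponent le_top
  have hcl : hφ2.toLp _ ∉ closure {y : Lp ℝ 2 P | (y : Ω → ℝ) ∈ C} := by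
    intro hmem
    obtain ⟨y, hy, hyd⟩ := Metric.mem_closure_iff.1 hmem δ hδ
    rw [dist_comm, dist_eq_norm] at hyd
    refine absurd (hdist y hy) (not_le.2 (lt_of_le_of_lt ?_ hyd))
    refine le_trans (le_of_eq ?_) (integral_abs_le_norm_Lp_two _)
    refine integral_congr_ae ?_
    filter_upwards [Lp.coeFn_sub y (hφ2.toLp _), hφ2.coeFn_toLp] with ω h1 h2
    rw [h1, Pi.sub_apply, h2]
  obtain ⟨h, u, hm, hh2, hlt, hgt⟩ :=
    exists_separating_memLp_two hC.convex_Lp_two.closure isClosed_closure hcl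
  have hh : Integrable h P := hh2.integrable (by norm_num)
  have hltC : ∀ Y ∈ C, ∫ ω, h ω * Y ω ∂P < u := fun Y hY => by
    have hY2 : MemLp Y 2 P := (hC.memLp Y hY).mono_exponent le_top
    have := hlt (hY2.toLp _) (subset_closure (hC.congr hY hY2.coeFn_toLp.symm))
    rwa [integral_congr_ae (g := fun ω => h ω * Y ω)
      (hY2.coeFn_toLp.mono fun ω hω => by simp only [hω])] at this
  have h0 := hC.nonneg_of_bounded_above hne hm hh hltC
  -- The separated point is the discretisation; as it lies below `Z` and `h` is nonnegative, `Z` is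
  -- separated too.
  have hgtZ : u < ∫ ω, h ω * Z ω ∂P := by
    rw [integral_congr_ae (g := fun ω => h ω * φ (d ω))
      (hφ2.coeFn_toLp.mono fun ω hω => by simp only [hω])] at hgt
    refine hgt.trans_le (integral_mono_ae (hh.mul_of_top_left hφt) (hh.mul_of_top_left hZt) ?_)
    filter_upwards [h0] with ω hω
    exact mul_le_mul_of_nonneg_left (hφle ω) hω
  -- If `h` vanished, nonemptiness of `C` would give both `0 < u` and `u < 0`.
  have hpos : 0 < ∫ ω, h ω ∂P := by
    refine lt_of_le_of_ne (integral_nonneg_of_ae h0) fun he => ?_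
    have hzero : h =ᵐ[P] 0 := (integral_eq_zero_iff_of_nonneg_ae h0 hh).1 he.symm
    have hint : ∀ Y : Ω → ℝ, ∫ ω, h ω * Y ω ∂P = 0 := fun Y =>
      integral_eq_zero_of_ae (hzero.mono fun ω hω => by simp [hω])
    obtain ⟨Y₀, hY₀⟩ := hne
    have h1 := hltC Y₀ hY₀
    rw [hint] at h1 hgtZ
    exact lt_asymm h1 hgtZ
  obtain ⟨Q, hQ⟩ := exists_absContProb_integral_eq hm hh h0 hpos
  refine ⟨Q, fun Y hY => ?_⟩
  rw [hQ, hQ]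
  exact mul_lt_mul_of_pos_left ((hltC Y hY).trans hgtZ) (inv_pos.2 hpos)

end Separation

/-! ### Passage to the logarithmic scale -/

section Logarithm

variable {Ω : Type*} [MeasurableSpace Ω] {P : Measure Ω}

lemma LInftyPos.measurable (X : LInftyPos P) : Measurable X :=
  (Lp.stronglyMeasurable X.1).measurable

lemma LInftyPos.ae_pos (X : LInftyPos P) : ∀ᵐ ω ∂P, 0 < X ω := by
  obtain ⟨ε, hε, h⟩ := X.2
  exact h.mono fun ω hω => hε.trans_le hω

lemma LInftyPos.measurable_log (X : LInftyPos P) : Measurable fun ω => Real.log (X ω) :=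
  Real.measurable_log.comp X.measurable

lemma LInftyPos.exists_abs_log_le (X : LInftyPos P) : ∃ M, ∀ᵐ ω ∂P, |Real.log (X ω)| ≤ M := by
  obtain ⟨ε, hε, h⟩ := X.2
  obtain ⟨K, hK⟩ := exists_abs_le_of_memLp_top (Lp.memLp X.1)
  refine ⟨max (Real.log K) (-Real.log ε), ?_⟩
  filter_upwards [h, hK] with ω h1 h2
  have h0 := hε.trans_le h1
  have h3 := Real.log_le_log hε h1
  have h4 := Real.log_le_log h0 ((le_abs_self _).trans h2)
  exact abs_le.2 ⟨by linarith [le_max_right (Real.log K) (-Real.log ε)],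
    h4.trans (le_max_left _ _)⟩

lemma LInftyPos.memLp_log (X : LInftyPos P) : MemLp (fun ω => Real.log (X ω)) ∞ P := by
  obtain ⟨M, hM⟩ := X.exists_abs_log_le
  exact memLp_top_of_abs_le X.measurable_log.aestronglyMeasurable hM

lemma LInftyPos.integrable_log (X : LInftyPos P) (Q : AbsContProb P) :
    Integrable (fun ω => Real.log (X ω)) Q.1 := by
  have := Q.2.1
  obtain ⟨M, hM⟩ := X.exists_abs_log_le
  exact Integrable.of_bound X.measurable_log.aestronglyMeasurable M (Q.2.2.ae_le hM)

lemma exists_LInftyPos_ae_eq_exp {Y : Ω → ℝ} (hY : MemLp Y ∞ P) :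
    ∃ X : LInftyPos P, ∀ᵐ ω ∂P, X ω = Real.exp (Y ω) := by
  obtain ⟨M, hM⟩ := exists_abs_le_of_memLp_top hY
  have hexp : MemLp (fun ω => Real.exp (Y ω)) ∞ P := by
    refine memLp_top_of_abs_le (M := Real.exp M)
      (Real.continuous_exp.comp_aestronglyMeasurable hY.aestronglyMeasurable) ?_
    filter_upwards [hM] with ω hω
    rw [Real.abs_exp]
    exact Real.exp_le_exp.2 ((le_abs_self _).trans hω)
  refine ⟨⟨hexp.toLp _, Real.exp (-M), Real.exp_pos _, ?_⟩, hexp.coeFn_toLp⟩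
  filter_upwards [hM, hexp.coeFn_toLp] with ω h1 h2
  rw [h2]
  exact Real.exp_le_exp.2 (abs_le.1 h1).1

/-- The canonical Orlicz premium is the geometric mean. -/
lemma orliczPremium_eq_exp (Q : AbsContProb P) (X : LInftyPos P) :
    orliczPremium Q X = Real.exp (∫ ω, Real.log (X ω) ∂Q.1) := by
  have := Q.2.1
  have hset : {k : ℝ | 0 < k ∧ ∫ ω, Real.log (X ω / k) ∂Q.1 ≤ 0} =
      Set.Ici (Real.exp (∫ ω, Real.log (X ω) ∂Q.1)) := by
    ext k
    simp only [Set.mem_ofPred_eq, Set.mem_Ici]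
    have hint : 0 < k → ∫ ω, Real.log (X ω / k) ∂Q.1 =
        (∫ ω, Real.log (X ω) ∂Q.1) - Real.log k := fun hk => by
      rw [integral_congr_ae (g := fun ω => Real.log (X ω) - Real.log k),
        integral_sub (X.integrable_log Q) (integrable_const _)]
      · simp
      · filter_upwards [Q.2.2.ae_le X.ae_pos] with ω hω
        exact Real.log_div hω.ne' hk.ne'
    constructor
    · rintro ⟨hk, h⟩
      rw [hint hk, sub_nonpos] at h
      exact (Real.le_log_iff_exp_le hk).1 h
    · intro h
      have hk := (Real.exp_pos _).trans_le h
      refine ⟨hk, ?_⟩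
      rw [hint hk, sub_nonpos]
      exact (Real.le_log_iff_exp_le hk).2 h
  rw [orliczPremium, hset, csInf_Ici]

/-- The sublevel sets of the functional on the logarithmic scale. -/
lemma isLowerFamily_sublevel {ρ : LInftyPos P → ℝ≥0∞} (hmono : IsMonotone ρ)
    (hqlc : IsQuasiLogconvex ρ) (hcfb : IsContinuousFromBelow ρ) (hlaw : IsLawInvariant ρ)
    (c : ℝ≥0∞) :
    IsLowerFamily P {Y | ∃ X : LInftyPos P, ρ X ≤ c ∧ ∀ᵐ ω ∂P, X ω = Real.exp (Y ω)} where
  memLp := by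
    rintro Y ⟨X, -, hXY⟩
    refine X.memLp_log.ae_eq ?_
    filter_upwards [hXY] with ω hω
    rw [hω, Real.log_exp]
  down := by
    rintro Y ⟨X, hX, hXY⟩ Z hZ hZY
    obtain ⟨X', hX'⟩ := exists_LInftyPos_ae_eq_exp hZ
    refine ⟨X', (hmono X' X ?_).trans hX, hX'⟩
    filter_upwards [hXY, hX', hZY] with ω h1 h2 h3
    rw [h1, h2]
    exact Real.exp_le_exp.2 h3
  convex := by
    rintro Y₁ ⟨X₁, hX₁, hXY₁⟩ Y₂ ⟨X₂, hX₂, hXY₂⟩ a b ha hb hab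
    rcases ha.eq_or_lt with rfl | ha
    · obtain rfl : b = 1 := by linarith
      exact ⟨X₂, hX₂, by simpa using hXY₂⟩
    rcases hb.eq_or_lt with rfl | hb
    · obtain rfl : a = 1 := by linarith
      exact ⟨X₁, hX₁, by simpa using hXY₁⟩
    obtain rfl : b = 1 - a := by linarith
    have hlog : ∀ (X : LInftyPos P) (Y : Ω → ℝ), (∀ᵐ ω ∂P, X ω = Real.exp (Y ω)) →
        MemLp Y ∞ P := fun X Y h => X.memLp_log.ae_eq (h.mono fun ω hω => by
      show Real.log (X ω) = Y ω
      rw [hω, Real.log_exp])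
    obtain ⟨X, hX⟩ := exists_LInftyPos_ae_eq_exp
      (((hlog _ _ hXY₁).const_smul a).add ((hlog _ _ hXY₂).const_smul (1 - a)))
    refine ⟨X, (hqlc X₁ X₂ X a ha (by linarith) ?_).trans (max_le hX₁ hX₂), hX⟩
    filter_upwards [hXY₁, hXY₂, hX] with ω h1 h2 h3
    rw [h1, h2, h3, ← Real.exp_mul, ← Real.exp_mul, ← Real.exp_add]
    simp only [Pi.add_apply, Pi.smul_apply, smul_eq_mul]
    ring_nf
  fromBelow := by
    intro Y Z hY hZ hm hl
    choose X hX hXY using hY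
    obtain ⟨X', hX'⟩ := exists_LInftyPos_ae_eq_exp hZ
    have hall : ∀ᵐ ω ∂P, ∀ n, X n ω = Real.exp (Y n ω) := ae_all_iff.2 hXY
    refine ⟨X', le_of_tendsto' (hcfb X X' ?_ ?_) hX, hX'⟩
    · filter_upwards [hall, hm] with ω h1 h2 n m hnm
      simp only [h1]
      exact Real.exp_le_exp.2 (h2 hnm)
    · filter_upwards [hall, hl, hX'] with ω h1 h2 h3
      simp only [h1, h3]
      exact (Real.continuous_exp.tendsto _).comp h2
  law := by
    rintro Y ⟨X, hX, hXY⟩ Z hYZ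
    have hY : MemLp Y ∞ P := X.memLp_log.ae_eq (hXY.mono fun ω hω => by
      show Real.log (X ω) = Y ω
      rw [hω, Real.log_exp])
    obtain ⟨X', hX'⟩ := exists_LInftyPos_ae_eq_exp (hYZ.memLp_iff.1 hY)
    have h1 : IdentDistrib X (fun ω => Real.exp (Y ω)) P P :=
      IdentDistrib.of_ae_eq X.measurable.aemeasurable hXY
    have h2 : IdentDistrib X' (fun ω => Real.exp (Z ω)) P P :=
      IdentDistrib.of_ae_eq X'.measurable.aemeasurable hX'
    have h3 : IdentDistrib X X' P P := (h1.trans (hYZ.comp Real.measurable_exp)).trans h2.symm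
    exact ⟨X', (hlaw X X' h3) ▸ hX, hX'⟩

end Logarithm

/-! ### The two bounds of the dual representation -/

section Representation

variable {Ω : Type*} [MeasurableSpace Ω] {P : Measure Ω}

/-- The lower bound in the dual representation: for any level below `ρ X`, the dual functional at
some measure exceeds that level. -/
lemma exists_le_dualFun [IsProbabilityMeasure P] (hP : IsNonatomic P) {ρ : LInftyPos P → ℝ≥0∞}
    (hmono : IsMonotone ρ) (hqlc : IsQuasiLogconvex ρ) (hcfb : IsContinuousFromBelow ρ)
    (hlaw : IsLawInvariant ρ) (X : LInftyPos P) {c : ℝ≥0∞} (hc : c < ρ X) :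
    ∃ Q : AbsContProb P, c ≤ dualFun ρ (∫ ω, Real.log (X ω) ∂Q.1) Q := by
  have hC := isLowerFamily_sublevel hmono hqlc hcfb hlaw c
  obtain ⟨M', hM'⟩ := X.exists_abs_log_le
  set M := max M' 0
  -- Truncation gives a version of `log X` bounded everywhere, as the separation theorem requires.
  let Z : Ω → ℝ := fun ω => max (-M) (min M (Real.log (X ω)))
  have hMM : -M ≤ M := by linarith [le_max_right M' 0]
  have hZM : ∀ ω, |Z ω| ≤ M := fun ω =>
    abs_le.2 ⟨le_max_left _ _, max_le hMM (min_le_left _ _)⟩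
  have hZX : ∀ᵐ ω ∂P, Z ω = Real.log (X ω) := by
    filter_upwards [hM'] with ω hω
    have := abs_le.1 (hω.trans (le_max_left M' 0))
    simp only [Z]
    rw [min_eq_right this.2, max_eq_right this.1]
  have hZm : Measurable Z := measurable_const.max (measurable_const.min X.measurable_log)
  obtain ⟨Q, hQ⟩ := hC.exists_integral_lt hP hZm hZM (by
    rintro ⟨X', hX', hXZ⟩
    refine absurd ((hmono X X' ?_).trans hX') (not_le.2 hc)
    filter_upwards [hXZ, hZX, X.ae_pos] with ω h1 h2 h3
    rw [h1, h2, Real.exp_log h3])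
  refine ⟨Q, le_iInf₂ fun Y hY => ?_⟩
  -- A competitor with `ρ Y < c` lies in the sublevel set, so its logarithmic mean under `Q` falls
  -- strictly below that of `X`.
  by_contra! hlt
  have h := hQ (fun ω => Real.log (Y ω)) ⟨Y, hlt.le, Y.ae_pos.mono fun ω hω =>
    (Real.exp_log hω).symm⟩
  rw [integral_congr_ae (Q.2.2.ae_le hZX)] at h
  exact absurd hY (not_le.2 h)

/-- Among the random variables with the law of `X` there is one whose logarithmic mean under `Q`
dominates the logarithmic means of `X` under all measures with the density law of `Q`. -/
lemma exists_identDistrib_integral_log_le [IsProbabilityMeasure P] (hP : IsNonatomic P)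
    (Q : AbsContProb P) (X : LInftyPos P) :
    ∃ Y : LInftyPos P, IdentDistrib X Y P P ∧ ∀ Q' : SameDensityLaw Q,
      ∫ ω, Real.log (X ω) ∂Q'.1.1 ≤ ∫ ω, Real.log (Y ω) ∂Q.1 := by
  obtain ⟨V, hV, hV0, hV1, hVa⟩ := hP.exists_atomless
  obtain ⟨M, hM⟩ := X.exists_abs_log_le
  obtain ⟨Z, hZ, hZM, hmap, hmv⟩ := exists_monovary_rearrangement hV hV0 hV1 hVa
    (Measure.measurable_rnDeriv Q.1 P).ennreal_toReal X.measurable_log.aemeasurable hM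
  obtain ⟨Y, hY⟩ := exists_LInftyPos_ae_eq_exp
    (memLp_top_of_abs_le (P := P) hZ.aestronglyMeasurable (ae_of_all _ hZM))
  have hid : IdentDistrib (fun ω => Real.log (X ω)) Z P P :=
    ⟨X.measurable_log.aemeasurable, hZ.aemeasurable, hmap.symm⟩
  have h1 : IdentDistrib X (fun ω => Real.exp (Real.log (X ω))) P P :=
    IdentDistrib.of_ae_eq X.measurable.aemeasurable
      (X.ae_pos.mono fun ω hω => (Real.exp_log hω).symm)
  have h2 : IdentDistrib Y (fun ω => Real.exp (Z ω)) P P :=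
    IdentDistrib.of_ae_eq Y.measurable.aemeasurable hY
  refine ⟨Y, (h1.trans (hid.comp Real.measurable_exp)).trans h2.symm, fun Q' => ?_⟩
  have := Q.2.1
  have := Q'.1.2.1
  have hYZ : ∀ᵐ ω ∂P, Real.log (Y ω) = Z ω := hY.mono fun ω hω => by rw [hω, Real.log_exp]
  rw [integral_congr_ae (Q.2.2.ae_le hYZ)]
  exact integral_le_of_monovary_rnDeriv Q.2.2 Q'.1.2.2 Q'.2 hZ X.measurable_log hmap
    (ae_of_all _ hZM) hM hmv

/-- An essential bound on `log X` serves all `Q'` at once. It also ensures that the real supremum is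
genuine and not the default value `0`. -/
lemma bddAbove_range_orliczPremium (Q : AbsContProb P) (X : LInftyPos P) :
    BddAbove (Set.range fun Q' : SameDensityLaw Q => orliczPremium Q'.1 X) := by
  obtain ⟨M, hM⟩ := X.exists_abs_log_le
  refine ⟨Real.exp M, ?_⟩
  rintro _ ⟨Q', rfl⟩
  have := Q'.1.2.1
  show orliczPremium Q'.1 X ≤ Real.exp M
  rw [orliczPremium_eq_exp]
  refine Real.exp_le_exp.2 ((integral_mono_ae (X.integrable_log Q'.1) (integrable_const M) ?_).trans
    (by simp))
  exact Q'.1.2.2.ae_le (hM.mono fun ω hω => (le_abs_self _).trans hω)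

/-- A measure, as a member of its own class of measures with the same density law. -/
def SameDensityLaw.self (Q : AbsContProb P) : SameDensityLaw Q :=
  ⟨Q, IdentDistrib.refl (Measure.measurable_rnDeriv _ _).aemeasurable⟩

/-- A single rearrangement of `X` satisfies the constraint for the supremum itself, and law
invariance gives it the value `ρ X`. -/
lemma geomDualFun_iSup_le [IsProbabilityMeasure P] (hP : IsNonatomic P) {ρ : LInftyPos P → ℝ≥0∞}
    (hlaw : IsLawInvariant ρ) (Q : AbsContProb P) (X : LInftyPos P) :
    geomDualFun ρ (⨆ Q' : SameDensityLaw Q, orliczPremium Q'.1 X) Q ≤ ρ X := by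
  obtain ⟨Y, hXY, hY⟩ := exists_identDistrib_integral_log_le hP Q X
  have : Nonempty (SameDensityLaw Q) := ⟨SameDensityLaw.self Q⟩
  rw [hlaw X Y hXY]
  refine iInf₂_le Y ?_
  have hpos : 0 < ⨆ Q' : SameDensityLaw Q, orliczPremium Q'.1 X := by
    refine lt_of_lt_of_le ?_
      (le_ciSup (bddAbove_range_orliczPremium Q X) (SameDensityLaw.self Q))
    rw [orliczPremium_eq_exp]
    exact Real.exp_pos _
  rw [Real.log_le_iff_le_exp hpos]
  refine ciSup_le fun Q' => ?_
  rw [orliczPremium_eq_exp]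
  exact Real.exp_le_exp.2 (hY Q')

lemma geomDualFun_mono {ρ : LInftyPos P → ℝ≥0∞} (Q : AbsContProb P) {s t : ℝ} (hs : 0 < s)
    (hst : s ≤ t) : geomDualFun ρ s Q ≤ geomDualFun ρ t Q :=
  le_iInf₂ fun Y hY => iInf₂_le Y ((Real.log_le_log hs hst).trans hY)

lemma le_iSup_iSup_geomDualFun [IsProbabilityMeasure P] (hP : IsNonatomic P)
    {ρ : LInftyPos P → ℝ≥0∞} (hmono : IsMonotone ρ) (hqlc : IsQuasiLogconvex ρ)
    (hcfb : IsContinuousFromBelow ρ) (hlaw : IsLawInvariant ρ) (X : LInftyPos P) :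
    ρ X ≤ ⨆ Q : AbsContProb P, ⨆ Q' : SameDensityLaw Q,
      geomDualFun ρ (orliczPremium Q'.1 X) Q := by
  refine le_of_forall_lt fun c hc => ?_
  obtain ⟨c', hcc', hc'⟩ := exists_between hc
  obtain ⟨Q, hQ⟩ := exists_le_dualFun hP hmono hqlc hcfb hlaw X hc'
  refine hcc'.trans_le (hQ.trans ?_)
  refine le_iSup_of_le Q (le_iSup_of_le (SameDensityLaw.self Q) ?_)
  show _ ≤ geomDualFun ρ (orliczPremium Q X) Q
  rw [orliczPremium_eq_exp, geomDualFun, Real.log_exp]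

lemma iSup_iSup_geomDualFun_le {ρ : LInftyPos P → ℝ≥0∞} (X : LInftyPos P) :
    (⨆ Q : AbsContProb P, ⨆ Q' : SameDensityLaw Q, geomDualFun ρ (orliczPremium Q'.1 X) Q) ≤
      ⨆ Q : AbsContProb P,
        geomDualFun ρ (⨆ Q' : SameDensityLaw Q, orliczPremium Q'.1 X) Q := by
  refine iSup_mono fun Q => iSup_le fun Q' => geomDualFun_mono Q ?_
    (le_ciSup (bddAbove_range_orliczPremium Q X) Q')
  rw [orliczPremium_eq_exp]
  exact Real.exp_pos _

end Representation

end ReturnRisk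

theorem mainTheorem5 {Ω : Type*} [MeasurableSpace Ω] (P : Measure Ω) [IsProbabilityMeasure P]
    (hP : ReturnRisk.IsNonatomic P)
    (ρ : ReturnRisk.LInftyPos P → ℝ≥0∞)
    (hmono : ReturnRisk.IsMonotone ρ)
    (hqlc : ReturnRisk.IsQuasiLogconvex ρ)
    (hcfb : ReturnRisk.IsContinuousFromBelow ρ)
    (hlaw : ReturnRisk.IsLawInvariant ρ) :
    (∀ (Q : ReturnRisk.AbsContProb P) (X : ReturnRisk.LInftyPos P),
      ReturnRisk.orliczPremium Q X = Real.exp (∫ ω, Real.log (X ω) ∂Q.1)) ∧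
    (∀ (Q : ReturnRisk.AbsContProb P) (X : ReturnRisk.LInftyPos P),
      BddAbove (Set.range fun Q' : ReturnRisk.SameDensityLaw Q =>
        ReturnRisk.orliczPremium Q'.1 X)) ∧
    ∀ X : ReturnRisk.LInftyPos P,
      ρ X = (⨆ Q : ReturnRisk.AbsContProb P,
        ReturnRisk.geomDualFun ρ
          (⨆ Q' : ReturnRisk.SameDensityLaw Q, ReturnRisk.orliczPremium Q'.1 X) Q) ∧
      ρ X = (⨆ Q : ReturnRisk.AbsContProb P, ⨆ Q' : ReturnRisk.SameDensityLaw Q,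
        ReturnRisk.geomDualFun ρ (ReturnRisk.orliczPremium Q'.1 X) Q) := by
  refine ⟨ReturnRisk.orliczPremium_eq_exp, ReturnRisk.bddAbove_range_orliczPremium, fun X => ?_⟩
  have h1 := ReturnRisk.le_iSup_iSup_geomDualFun hP hmono hqlc hcfb hlaw X
  have h2 := ReturnRisk.iSup_iSup_geomDualFun_le (ρ := ρ) X
  have h3 := iSup_le fun Q => ReturnRisk.geomDualFun_iSup_le hP hlaw Q X
  exact ⟨le_antisymm (h1.trans h2) h3, le_antisymm h1 (h2.trans h3)⟩
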